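/- Let $k$ be a field and let $\mathcal A$ be a finite set of hyperplanes through the origin in $\mathbb R^d$; for each $H\in\mathcal A$ fix a labelling $H^+,H^-$ of its two open half-spaces and put $H^0=H$. A face of $\mathcal A$ is a nonempty intersection $x=\bigcap_{H\in\mathcal A}H^{\sigma_H(x)}$ with $\sigma_H(x)\in\{+,-,0\}$. The set $\mathcal F$ of faces is a monoid under the product $xy$ with $\sigma_H(xy)=\sigma_H(x)$ if $\sigma_H(x)\ne 0$ and $\sigma_H(xy)=\sigma_H(y)$ if $\sigma_H(x)=0$; let $k\mathcal F$ be its monoid algebra. The support of a face is $\operatorname{supp}(x)=\bigcap_{\sigma_H(x)=0}H$, and $\mathcal L=\operatorname{supp}(\mathcal F)$, ordered by inclusion, is the intersection lattice. For $X\in\mathcal L$ let $k_X$ be the left $k\mathcal F$-module $k$ on which $y\in\mathcal F$ acts as $1$ if $\operatorname{supp}(y)\le X$ and as $0$ otherwise. (1) For all $X,Y\in\mathcal L$ and all integers $p\ge 0$, there is an isomorphism of $k$-vector spaces $$\operatorname{Ext}^p_{k\mathcal F}(k_X,k_Y)\cong\begin{cases}k,&\text{if } Y\le X\text{ and }\dim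 X-\dim Y=p,\\ 0,&\text{otherwise.}\end{cases}$$ (2) The algebra $k\mathcal F$ is split basic, that is, it is finite dimensional and each of its simple modules has dimension one over $k$. Its $\operatorname{Ext}$-quiver, the quiver whose vertices are the isomorphism classes of simple $k\mathcal F$-modules and which has $\dim_k\operatorname{Ext}^1_{k\mathcal F}(S,T)$ arrows from the class of $S$ to the class of $T$, is the Hasse diagram of $\mathcal L$ with its cover relations oriented downwards: $X\mapsto[k_X]$ is a bijection from $\mathcal L$ to the set of vertices, and there is exactly one arrow $[k_X]\to[k_Y]$ if $X$ covers $Y$ in $\mathcal L$, and no arrow otherwise. -/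

import Mathlib

open CategoryTheory

universe u

/-- A central hyperplane arrangement in `ℝ^d`: a finite set of linear hyperplanes, together with
the (arbitrary but fixed) choice, for each hyperplane `H`, of which open half-space is called `H⁺`
and which is called `H⁻`. The choice is recorded by a linear form with kernel `H`. -/
structure CentralArrangement (d : ℕ) where
  hyperplanes : Finset (Submodule ℝ (Fin d → ℝ))
  finrank_add_one : ∀ H ∈ hyperplanes, Module.finrank ℝ H + 1 = d
  form : hyperplanes → Module.Dual ℝ (Fin d → ℝ)
  ker_form : ∀ H : hyperplanes, LinearMap.ker (form H) = H.1

namespace CentralArrangement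

variable {d : ℕ} (𝒜 : CentralArrangement d)

/-- `H^σ` for `σ ∈ {0, -, +}`: the hyperplane `H` itself and its two open half-spaces. -/
def region (H : 𝒜.hyperplanes) : SignType → Set (Fin d → ℝ)
  | .zero => (H.1 : Set (Fin d → ℝ))
  | .neg => {v | 𝒜.form H v < 0}
  | .pos => {v | 0 < 𝒜.form H v}

theorem mem_region_iff (H : 𝒜.hyperplanes) (s : SignType) (v : Fin d → ℝ) :
    v ∈ 𝒜.region H s ↔ SignType.sign (𝒜.form H v) = s := by
  rcases s with _ | _ | _
  · change v ∈ H.1 ↔ SignType.sign (𝒜.form H v) = 0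
    rw [← 𝒜.ker_form H, LinearMap.mem_ker, sign_eq_zero_iff]
  · change 𝒜.form H v < 0 ↔ SignType.sign (𝒜.form H v) = -1
    rw [sign_eq_neg_one_iff]
  · change 0 < 𝒜.form H v ↔ SignType.sign (𝒜.form H v) = 1
    rw [sign_eq_one_iff]

/-- A face of the arrangement: a nonempty intersection `⋂_H H^{σ_H}`, given by its sign sequence
`σ` (which the intersection determines, see `Face.carrier_injective`). -/
@[ext]
structure Face where
  sign : 𝒜.hyperplanes → SignType
  nonempty : (⋂ H, 𝒜.region H (sign H)).Nonempty

namespace Face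

variable {𝒜}

/-- The face as a subset of `ℝ^d`. -/
def carrier (x : 𝒜.Face) : Set (Fin d → ℝ) := ⋂ H, 𝒜.region H (x.sign H)

theorem mem_carrier_iff (x : 𝒜.Face) (v : Fin d → ℝ) :
    v ∈ x.carrier ↔ ∀ H, SignType.sign (𝒜.form H v) = x.sign H := by
  simp [carrier, mem_region_iff]

theorem carrier_injective : Function.Injective (carrier : 𝒜.Face → Set (Fin d → ℝ)) := by
  intro x y h
  obtain ⟨v, hv⟩ := x.nonempty
  have hx : v ∈ x.carrier := hv
  have hy : v ∈ y.carrier := h ▸ hx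
  rw [mem_carrier_iff] at hx hy
  ext1
  funext H
  rw [← hx H, hy H]

/-- The sign sequence of the product `x y`: that of `x` where it is nonzero, else that of `y`. -/
def mulSign (x y : 𝒜.Face) (H : 𝒜.hyperplanes) : SignType :=
  if x.sign H ≠ 0 then x.sign H else y.sign H

theorem mulSign_nonempty (x y : 𝒜.Face) : (⋂ H, 𝒜.region H (mulSign x y H)).Nonempty := by
  obtain ⟨v, hv⟩ := x.nonempty
  obtain ⟨w, hw⟩ := y.nonempty
  have hx := (mem_carrier_iff x v).1 hv
  have hy := (mem_carrier_iff y w).1 hw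
  have key : ∀ᶠ ε : ℝ in nhdsWithin 0 (Set.Ioi 0), ∀ H,
      SignType.sign (𝒜.form H (v + ε • w)) = mulSign x y H := by
    rw [Filter.eventually_all]
    intro H
    have hc : Filter.Tendsto (fun ε : ℝ => 𝒜.form H (v + ε • w)) (nhdsWithin 0 (Set.Ioi 0))
        (nhds (𝒜.form H v)) := by
      have : Continuous fun ε : ℝ => 𝒜.form H v + ε * 𝒜.form H w := by fun_prop
      simpa using (this.tendsto 0).mono_left nhdsWithin_le_nhds
    rcases lt_trichotomy (𝒜.form H v) 0 with h | h | h
    · filter_upwards [hc.eventually_lt_const h] with ε hε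
      have : x.sign H = -1 := by rw [← hx H, sign_neg h]
      rw [sign_neg hε]
      simp [mulSign, this]
    · filter_upwards [self_mem_nhdsWithin] with ε hε
      have hε : 0 < ε := hε
      have : x.sign H = 0 := by rw [← hx H, h, sign_zero]
      simp [mulSign, this, h, sign_mul, sign_pos hε, hy H]
    · filter_upwards [hc.eventually_const_lt h] with ε hε
      have : x.sign H = 1 := by rw [← hx H, sign_pos h]
      rw [sign_pos hε]
      simp [mulSign, this]
  obtain ⟨ε, hε⟩ := key.exists
  exact ⟨v + ε • w, Set.mem_iInter.2 fun H => (mem_region_iff _ _ _ _).2 (hε H)⟩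

/-- The face semigroup; its identity is the intersection of all the hyperplanes. -/
instance : Monoid 𝒜.Face where
  mul x y := ⟨mulSign x y, mulSign_nonempty x y⟩
  one := ⟨fun _ => 0, 0, Set.mem_iInter.2 fun H => (mem_region_iff _ _ _ _).2 (by simp)⟩
  mul_assoc x y z := by
    refine Face.ext (funext fun H => ?_)
    change (if (if x.sign H ≠ 0 then x.sign H else y.sign H) ≠ 0 then
        (if x.sign H ≠ 0 then x.sign H else y.sign H) else z.sign H) =
      if x.sign H ≠ 0 then x.sign H else if y.sign H ≠ 0 then y.sign H else z.sign H
    split_ifs <;> simp_all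
  one_mul x := by
    refine Face.ext (funext fun H => ?_)
    change (if (0 : SignType) ≠ 0 then 0 else x.sign H) = x.sign H
    simp
  mul_one x := by
    refine Face.ext (funext fun H => ?_)
    change (if x.sign H ≠ 0 then x.sign H else 0) = x.sign H
    split_ifs <;> simp_all

theorem sign_mul (x y : 𝒜.Face) (H : 𝒜.hyperplanes) :
    (x * y).sign H = if x.sign H ≠ 0 then x.sign H else y.sign H := rfl

theorem sign_one (H : 𝒜.hyperplanes) : (1 : 𝒜.Face).sign H = 0 := rfl

/-- The support of a face: the intersection of the hyperplanes of the arrangement containing it. -/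
def supp (x : 𝒜.Face) : Submodule ℝ (Fin d → ℝ) := ⨅ H, ⨅ _ : x.sign H = 0, H.1

theorem sign_eq_zero_iff (x : 𝒜.Face) (H : 𝒜.hyperplanes) : x.sign H = 0 ↔ x.supp ≤ H.1 := by
  constructor
  · exact fun h => iInf₂_le H h
  · intro h
    obtain ⟨v, hv⟩ := x.nonempty
    have hx := (mem_carrier_iff x v).1 hv
    have hs : v ∈ x.supp := by
      simp only [supp, Submodule.mem_iInf]
      intro K hK
      have := Set.mem_iInter.1 hv K
      rwa [hK] at this
    have hvH : v ∈ H.1 := h hs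
    rw [← 𝒜.ker_form H, LinearMap.mem_ker] at hvH
    rw [← hx H, hvH, sign_zero]

theorem supp_le_supp_iff (x y : 𝒜.Face) :
    x.supp ≤ y.supp ↔ ∀ H, y.sign H = 0 → x.sign H = 0 := by
  constructor
  · intro h H hH
    rw [sign_eq_zero_iff] at hH ⊢
    exact h.trans hH
  · intro h
    exact le_iInf₂ fun H hH => iInf₂_le H (h H hH)

theorem supp_one_le (y : 𝒜.Face) : (1 : 𝒜.Face).supp ≤ y.supp :=
  (supp_le_supp_iff _ _).2 fun _ _ => rfl

theorem supp_mul_le_iff (x y z : 𝒜.Face) :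
    (x * y).supp ≤ z.supp ↔ x.supp ≤ z.supp ∧ y.supp ≤ z.supp := by
  simp only [supp_le_supp_iff, sign_mul]
  constructor
  · intro h
    constructor <;> intro H hH <;> have := h H hH <;> split_ifs at this <;> simp_all
  · rintro ⟨hx, hy⟩ H hH
    simp [hx H hH, hy H hH]

end Face

/-- The intersection lattice: the set of supports of faces, ordered by inclusion. -/
abbrev IntersectionLattice : Type := {X : Submodule ℝ (Fin d → ℝ) // X ∈ Set.range (Face.supp (𝒜 := 𝒜))}

section Algebra

variable (k : Type u) [Field k]

/-- The face semigroup algebra `kℱ`. -/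
abbrev FaceAlgebra : Type u := MonoidAlgebra k 𝒜.Face

variable {𝒜}

open Classical in
/-- The character `χ_X` on faces: `χ_X(y) = 1` if `supp y ≤ X`, and `0` otherwise. -/
noncomputable def characterOnFaces (X : 𝒜.IntersectionLattice) : 𝒜.Face →* k where
  toFun y := if y.supp ≤ X.1 then 1 else 0
  map_one' := by
    obtain ⟨_, z, rfl⟩ := X
    simp [Face.supp_one_le]
  map_mul' x y := by
    obtain ⟨_, z, rfl⟩ := X
    simp only [Face.supp_mul_le_iff]
    split_ifs <;> simp_all

/-- The irreducible representation `χ_X : kℱ → k`. -/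
noncomputable def character (X : 𝒜.IntersectionLattice) : 𝒜.FaceAlgebra k →ₐ[k] k :=
  MonoidAlgebra.lift k k 𝒜.Face (characterOnFaces k X)

/-- The `kℱ`-module `k_X`: the field `k`, on which `kℱ` acts through `χ_X`. -/
noncomputable def simpleModule (X : 𝒜.IntersectionLattice) : ModuleCat.{u} (𝒜.FaceAlgebra k) :=
  (ModuleCat.restrictScalars (character k X).toRingHom).obj (ModuleCat.of k k)

theorem character_surjective (X : 𝒜.IntersectionLattice) :
    Function.Surjective (character k X) := fun c =>
  ⟨algebraMap k _ c, (character k X).commutes c⟩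

instance isSimpleModule_simpleModule (X : 𝒜.IntersectionLattice) :
    IsSimpleModule (𝒜.FaceAlgebra k) (simpleModule k X) := by
  let σ : 𝒜.FaceAlgebra k →+* k := (character k X).toRingHom
  have : RingHomSurjective σ := ⟨character_surjective k X⟩
  let f : simpleModule k X →ₛₗ[σ] k :=
    { toFun := fun m => (m : k)
      map_add' := fun _ _ => rfl
      map_smul' := fun _ _ => rfl }
  exact (LinearMap.isSimpleModule_iff_of_bijective f Function.bijective_id).2 inferInstance

end Algebra

end CentralArrangement

section ExtQuiver

/-- A finite dimensional `k`-algebra is split basic if all its simple modules have dimension one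
over `k`. -/
def IsSplitBasic (k A : Type u) [Field k] [Ring A] [Algebra k A] : Prop :=
  Module.Finite k A ∧
    ∀ (M : Type u) [AddCommGroup M] [Module k M] [Module A M] [IsScalarTower k A M],
      IsSimpleModule A M → Module.finrank k M = 1

/-- Isomorphism of simple `A`-modules. -/
def simpleModuleSetoid (A : Type u) [Ring A] :
    Setoid {M : ModuleCat.{u} A // IsSimpleModule A M} where
  r M N := Nonempty (M.1 ≅ N.1)
  iseqv := ⟨fun _ => ⟨Iso.refl _⟩, fun ⟨e⟩ => ⟨e.symm⟩, fun ⟨e⟩ ⟨f⟩ => ⟨e.trans f⟩⟩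

/-- The vertices of the `Ext`-quiver of the `k`-algebra `A`: the isomorphism classes of simple
`A`-modules. -/
def ExtQuiver (k A : Type u) [Field k] [Ring A] [Algebra k A] : Type (u + 1) :=
  Quotient (simpleModuleSetoid A)

namespace ExtQuiver

variable {k A : Type u} [Field k] [Ring A] [Algebra k A]

/-- The vertex given by a simple module. -/
def mk (M : ModuleCat.{u} A) [h : IsSimpleModule A M] : ExtQuiver k A :=
  Quotient.mk (simpleModuleSetoid A) ⟨M, h⟩

/-- A simple module in the isomorphism class `x`. -/
noncomputable def rep (x : ExtQuiver k A) : ModuleCat.{u} A := (Quotient.out x).1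

/-- The number of arrows from `x` to `y` is the dimension of `Ext¹_A(S_x, S_y)`. -/
noncomputable instance : Quiver (ExtQuiver k A) where
  Hom x y := Fin (Module.finrank k (Abelian.Ext (rep x) (rep y) 1))

end ExtQuiver

/-- The vertices of the Hasse diagram of a poset. -/
def HasseQuiver (P : Type*) [PartialOrder P] : Type _ := P

/-- The cover relations oriented downwards: one arrow `x ⟶ y` if `x` covers `y`, none otherwise. -/
instance (P : Type*) [PartialOrder P] : Quiver (HasseQuiver P) where
  Hom x y := PLift (@CovBy P _ y x)

end ExtQuiver

/-! Fix `X` in the lattice. The faces lying in `X` decompose it into relatively open convex cones.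
Let `P i` be spanned by the faces whose support has codimension `i` in `X`, where a face `w` sends
`x` to `w * x` if `w.supp ≤ x.supp` and to `0` otherwise. The cellular coboundary `P (i + 1) → P i`,
together with the map `P 0 → k_X` sending every chamber of `X` to `1`, is a projective resolution of
`k_X`, for the following reasons.

Linearity (`sum_incidence_of_mul_eq`): if `w.supp ≤ x.supp`, left multiplication by `w` preserves
the cofaces of `x` and their incidence numbers. Otherwise those cofaces of `x` that `w` does not
kill fall into pairs of opposite incidence with the same image under `w`, and cancel.

Exactness (`IsConvex.acyclic`): the cochains on the cells of an open convex set compute its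
compactly supported cohomology, which is `k` in top degree and is detected by summing over the top
cells. The proof is an induction that cuts the convex set along a hyperplane.

Projectivity: `xyx = xy` holds for faces, and it yields elements `cutoff` of the algebra that split
the obvious surjection from a free module onto `P i`.

A map from `P i` to `k_Y` can be nonzero only on cells of support `Y`, and is constant on these
(`hom_eq_zero`, `exists_hom_generator`). So `Hom(P i, k_Y)` is `k` if `Y ≤ X` has codimension `i`
and `0` otherwise. No two consecutive terms contribute, the differentials of the Hom complex vanish,
and `Ext` is read off.

For the quiver, a face of largest support acting nontrivially on a simple module sends some vector
to a nonzero one that spans the module and affords the character of that support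
(`exists_hasCharacter`). Codimension one is the cover relation because the trace of a hyperplane on
an element of the lattice is again in the lattice (`hasCodim_one_iff_covBy`). -/

section Orientation

/-! ### Coherent orientations of subspaces -/

open Module ExteriorAlgebra

variable {V : Type*} [AddCommGroup V] [Module ℝ V]

/-- A retraction of `V` onto the span of `w` pulls the determinant in the basis `w` back to an
alternating form on `V`. It factors through the exterior algebra and takes the value 1 on `w`. -/
theorem ExteriorAlgebra.ιMulti_ne_zero {n : ℕ} {w : Fin n → V} (hw : LinearIndependent ℝ w) :
    ιMulti ℝ n w ≠ 0 := by
  intro h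
  let b := Basis.span hw
  obtain ⟨p, hp⟩ := (Submodule.span ℝ (Set.range w)).subtype.exists_leftInverse_of_injective
    (Submodule.ker_subtype _)
  have hpw : (fun i => p (w i)) = b := by
    funext i
    have : w i = (Submodule.span ℝ (Set.range w)).subtype (b i) := by simp [b, Basis.span_apply]
    rw [this]
    exact LinearMap.congr_fun hp (b i)
  have := congrArg (liftAlternating (R := ℝ) (M := V) (N := ℝ)
    (Pi.single n (b.det.compLinearMap p))) h
  rw [liftAlternating_apply_ιMulti, map_zero] at this
  simp only [Pi.single_eq_same, AlternatingMap.compLinearMap_apply] at this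
  change b.det (fun i => p (w i)) = 0 at this
  rw [hpw, Basis.det_self] at this
  exact one_ne_zero this

theorem AlternatingMap.eq_det_smul {M N : Type*} [AddCommGroup M] [Module ℝ M] [AddCommGroup N]
    [Module ℝ N] {n : ℕ} (b : Basis (Fin n) ℝ M) (f : M [⋀^Fin n]→ₗ[ℝ] N) (w : Fin n → M) :
    f w = b.det w • f b := by
  have : f = ((LinearMap.toSpanSingleton ℝ N (f b)).compAlternatingMap b.det) := by
    refine Basis.ext_alternating b fun i h => ?_
    let σ := Equiv.ofBijective i (Finite.injective_iff_bijective.1 h)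
    change f (b ∘ σ) = (LinearMap.toSpanSingleton ℝ N (f b)).compAlternatingMap b.det (b ∘ σ)
    rw [AlternatingMap.map_perm, AlternatingMap.map_perm]
    simp [b.det_self]
  conv_lhs => rw [this]
  simp

variable [FiniteDimensional ℝ V]

/-- The exterior product of a basis of a subspace. -/
noncomputable def volumeElement (X : Submodule ℝ V) : ExteriorAlgebra ℝ V :=
  ιMulti ℝ (finrank ℝ X) fun i => (finBasis ℝ X i : V)

theorem linearIndependent_finBasis_coe (X : Submodule ℝ V) :
    LinearIndependent ℝ fun i => (finBasis ℝ X i : V) :=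
  (finBasis ℝ X).linearIndependent.map' X.subtype (Submodule.ker_subtype X)

theorem span_finBasis_coe (X : Submodule ℝ V) :
    Submodule.span ℝ (Set.range fun i => (finBasis ℝ X i : V)) = X := by
  have : (Set.range fun i => (finBasis ℝ X i : V)) = X.subtype '' Set.range (finBasis ℝ X) := by
    rw [← Set.range_comp]; rfl
  rw [this, ← Submodule.map_span, Basis.span_eq, Submodule.map_top, Submodule.range_subtype]

theorem volumeElement_ne_zero (X : Submodule ℝ V) : volumeElement X ≠ 0 :=
  ιMulti_ne_zero (linearIndependent_finBasis_coe X)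

theorem ι_mul_volumeElement (X : Submodule ℝ V) (v : V) :
    ι ℝ v * volumeElement X =
      ιMulti ℝ (finrank ℝ X + 1) (Matrix.vecCons v fun i => (finBasis ℝ X i : V)) := by
  rw [ιMulti_succ_apply]
  rfl

theorem ι_mul_volumeElement_eq_zero_iff (X : Submodule ℝ V) (v : V) :
    ι ℝ v * volumeElement X = 0 ↔ v ∈ X := by
  rw [ι_mul_volumeElement]
  have hiff : LinearIndependent ℝ (Matrix.vecCons v fun i => (finBasis ℝ X i : V)) ↔ v ∉ X := by
    have := linearIndependent_finCons (K := ℝ) (x := v) (v := fun i => (finBasis ℝ X i : V))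
    rw [span_finBasis_coe] at this
    exact this.trans (and_iff_right (linearIndependent_finBasis_coe X))
  constructor
  · intro h
    by_contra hv
    exact ιMulti_ne_zero (hiff.2 hv) h
  · intro h
    exact AlternatingMap.map_linearDependent _ _ fun hl => hiff.1 hl h

theorem exists_ι_mul_volumeElement_eq_smul {X Y : Submodule ℝ V} (hXY : X ≤ Y)
    (h : finrank ℝ Y = finrank ℝ X + 1) {v : V} (hv : v ∈ Y) :
    ∃ c : ℝ, ι ℝ v * volumeElement X = c • volumeElement Y := by
  have key : ∀ n (w : Fin n → V), n = finrank ℝ Y → (∀ i, w i ∈ Y) →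
      ∃ c : ℝ, ιMulti ℝ n w = c • volumeElement Y := by
    rintro n w rfl hw
    exact ⟨_, AlternatingMap.eq_det_smul (finBasis ℝ Y)
      ((ιMulti ℝ (finrank ℝ Y)).compLinearMap Y.subtype) fun i => ⟨w i, hw i⟩⟩
  rw [ι_mul_volumeElement]
  refine key _ _ h.symm fun i => ?_
  refine Fin.cases hv (fun j => hXY (Subtype.coe_prop _)) i

variable (V) in
/-- A coherent system of linear forms comparing orientations of consecutive subspaces. -/
theorem exists_incidence_forms : ∃ g : Submodule ℝ V → Submodule ℝ V → V →ₗ[ℝ] ℝ,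
    (∀ X Y : Submodule ℝ V, X ≤ Y → finrank ℝ Y = finrank ℝ X + 1 → ∀ v ∈ Y, g X Y v = 0 ↔ v ∈ X) ∧
    ∀ X Y Y' Z : Submodule ℝ V, X ≤ Y → X ≤ Y' → Y ≤ Z → Y' ≤ Z → finrank ℝ Y = finrank ℝ X + 1 →
      finrank ℝ Y' = finrank ℝ X + 1 → finrank ℝ Z = finrank ℝ X + 2 → ∀ v ∈ Y, ∀ v' ∈ Y',
      g X Y v * g Y Z v' + g X Y' v' * g Y' Z v = 0 := by
  -- The functional `l X` reads off coefficients of `volumeElement X`; this makes `g X Y` linear on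
  -- all of `V`, whatever `X` and `Y` are.
  have hl : ∀ X : Submodule ℝ V, ∃ l : Dual ℝ (ExteriorAlgebra ℝ V), l (volumeElement X) = 1 := by
    intro X
    have := (not_congr (forall_dual_apply_eq_zero_iff ℝ (volumeElement X))).2
      (volumeElement_ne_zero X)
    push Not at this
    obtain ⟨f, hf⟩ := this
    exact ⟨(f (volumeElement X))⁻¹ • f, by simp [hf]⟩
  choose l hl using hl
  let g : Submodule ℝ V → Submodule ℝ V → V →ₗ[ℝ] ℝ := fun X Y =>
    l Y ∘ₗ LinearMap.mulRight ℝ (volumeElement X) ∘ₗ ι ℝ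
  have hg : ∀ X Y : Submodule ℝ V, X ≤ Y → finrank ℝ Y = finrank ℝ X + 1 → ∀ v ∈ Y,
      ι ℝ v * volumeElement X = g X Y v • volumeElement Y := by
    intro X Y hXY h v hv
    obtain ⟨c, hc⟩ := exists_ι_mul_volumeElement_eq_smul hXY h hv
    have : g X Y v = c := by
      change l Y (ι ℝ v * volumeElement X) = c
      rw [hc, map_smul, hl, smul_eq_mul, mul_one]
    rw [this, hc]
  refine ⟨g, ?_, ?_⟩
  · intro X Y hXY h v hv
    rw [← ι_mul_volumeElement_eq_zero_iff, hg X Y hXY h v hv, smul_eq_zero,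
      or_iff_left (volumeElement_ne_zero Y)]
  · intro X Y Y' Z hXY hXY' hYZ hYZ' h h' hZ v hv v' hv'
    have e1 : ι ℝ v' * (ι ℝ v * volumeElement X) = (g X Y v * g Y Z v') • volumeElement Z := by
      rw [hg X Y hXY h v hv, mul_smul_comm, hg Y Z hYZ (by omega) v' (hYZ' hv'), smul_smul]
    have e2 : ι ℝ v * (ι ℝ v' * volumeElement X) = (g X Y' v' * g Y' Z v) • volumeElement Z := by
      rw [hg X Y' hXY' h' v' hv', mul_smul_comm, hg Y' Z hYZ' (by omega) v (hYZ hv), smul_smul]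
    -- Wedging `v` and `v'` onto the volume of `X` in the two orders gives opposite results.
    have e3 : (g X Y v * g Y Z v' + g X Y' v' * g Y' Z v) • volumeElement Z = 0 := by
      rw [add_smul, ← e1, ← e2, ← mul_assoc, ← mul_assoc, ← add_mul, ι_add_mul_swap, zero_mul]
    exact (smul_eq_zero.1 e3).resolve_right (volumeElement_ne_zero Z)

end Orientation

/-! ### Faces, facets and incidence numbers -/

namespace CentralArrangement

namespace Face

variable {d : ℕ} {𝒜 : CentralArrangement d}

noncomputable instance : Fintype 𝒜.Face :=
  Fintype.ofInjective Face.sign fun _ _ => Face.ext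

noncomputable instance : DecidableEq 𝒜.Face := Classical.decEq _

/-- The face containing a given point. -/
noncomputable def ofPoint (𝒜 : CentralArrangement d) (v : Fin d → ℝ) : 𝒜.Face where
  sign H := SignType.sign (𝒜.form H v)
  nonempty := ⟨v, Set.mem_iInter.2 fun _ => (mem_region_iff _ _ _ _).2 rfl⟩

@[simp]
theorem sign_ofPoint (v : Fin d → ℝ) (H : 𝒜.hyperplanes) :
    (ofPoint 𝒜 v).sign H = SignType.sign (𝒜.form H v) := rfl

/-- A point of a face. -/
noncomputable def point (x : 𝒜.Face) : Fin d → ℝ := x.nonempty.some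

@[simp]
theorem sign_form_point (x : 𝒜.Face) (H : 𝒜.hyperplanes) :
    SignType.sign (𝒜.form H x.point) = x.sign H :=
  (mem_carrier_iff x _).1 x.nonempty.some_mem H

/-- The face opposite to a given one. -/
noncomputable def neg (x : 𝒜.Face) : 𝒜.Face := ofPoint 𝒜 (-x.point)

@[simp]
theorem sign_neg (x : 𝒜.Face) (H : 𝒜.hyperplanes) : x.neg.sign H = -x.sign H := by
  rw [neg, sign_ofPoint, map_neg, Left.sign_neg, sign_form_point]

theorem mul_self (x : 𝒜.Face) : x * x = x := by
  ext H
  rw [sign_mul]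
  split_ifs <;> rfl

theorem mul_mul_self (x y : 𝒜.Face) : x * y * x = x * y := by
  ext H
  simp only [sign_mul]
  split_ifs <;> simp_all

theorem mul_eq_left_iff {x y : 𝒜.Face} : x * y = x ↔ y.supp ≤ x.supp := by
  rw [supp_le_supp_iff, Face.ext_iff, funext_iff]
  refine forall_congr' fun H => ?_
  rw [sign_mul]
  split_ifs with h
  · simp [h]
  · rw [not_not] at h
    simp [h]

theorem supp_mul_of_le {x y : 𝒜.Face} (h : x.supp ≤ y.supp) : (x * y).supp = y.supp :=
  le_antisymm ((supp_mul_le_iff _ _ _).2 ⟨h, le_rfl⟩) ((supp_mul_le_iff _ _ _).1 le_rfl).2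

theorem left_supp_le_supp_mul (x y : 𝒜.Face) : x.supp ≤ (x * y).supp :=
  ((supp_mul_le_iff _ _ _).1 le_rfl).1

theorem right_supp_le_supp_mul (x y : 𝒜.Face) : y.supp ≤ (x * y).supp :=
  ((supp_mul_le_iff _ _ _).1 le_rfl).2

theorem mem_supp_iff (x : 𝒜.Face) (v : Fin d → ℝ) :
    v ∈ x.supp ↔ ∀ H, x.sign H = 0 → 𝒜.form H v = 0 := by
  simp only [supp, Submodule.mem_iInf]
  refine forall₂_congr fun H _ => ?_
  rw [← 𝒜.ker_form H, LinearMap.mem_ker]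

theorem form_eq_zero_of_mem_supp {x : 𝒜.Face} {v : Fin d → ℝ} (hv : v ∈ x.supp)
    {H : 𝒜.hyperplanes} (hH : x.sign H = 0) : 𝒜.form H v = 0 :=
  (x.mem_supp_iff v).1 hv H hH

theorem point_mem_supp (x : 𝒜.Face) : x.point ∈ x.supp := by
  rw [mem_supp_iff]
  intro H hH
  rwa [← sign_form_point, _root_.sign_eq_zero_iff] at hH

theorem form_point_eq_zero_iff (x : 𝒜.Face) (H : 𝒜.hyperplanes) :
    𝒜.form H x.point = 0 ↔ x.sign H = 0 := by
  rw [← sign_form_point, _root_.sign_eq_zero_iff]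

theorem sign_eq_zero_congr {x y : 𝒜.Face} (h : x.supp = y.supp) (H : 𝒜.hyperplanes) :
    x.sign H = 0 ↔ y.sign H = 0 := by
  rw [sign_eq_zero_iff, sign_eq_zero_iff, h]

theorem supp_congr {x y : 𝒜.Face} (h : ∀ H, x.sign H = 0 ↔ y.sign H = 0) : x.supp = y.supp :=
  le_antisymm ((supp_le_supp_iff _ _).2 fun H => (h H).2)
    ((supp_le_supp_iff _ _).2 fun H => (h H).1)

theorem supp_neg (x : 𝒜.Face) : x.neg.supp = x.supp :=
  supp_congr fun H => by rw [sign_neg, SignType.neg_eq_zero_iff]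

theorem sign_eq_of_mul_eq {x y : 𝒜.Face} (h : x * y = y) {H : 𝒜.hyperplanes}
    (hH : x.sign H ≠ 0) : y.sign H = x.sign H := by
  rw [← h, sign_mul, if_pos hH]

theorem sign_left_eq_zero {x y : 𝒜.Face} (h : x * y = y) {H : 𝒜.hyperplanes}
    (hH : y.sign H = 0) : x.sign H = 0 := by
  by_contra h'
  exact h' (by rw [← sign_eq_of_mul_eq h h', hH])

theorem mul_eq_right_iff {x y : 𝒜.Face} :
    x * y = y ↔ ∀ H, x.sign H ≠ 0 → y.sign H = x.sign H := by
  constructor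
  · exact fun h H hH => sign_eq_of_mul_eq h hH
  · intro h
    ext H
    rw [sign_mul]
    split_ifs with h'
    exacts [(h H h').symm, rfl]

theorem supp_le_of_mul_eq {x y : 𝒜.Face} (h : x * y = y) : x.supp ≤ y.supp :=
  h ▸ left_supp_le_supp_mul x y

/-- A face of `z` agrees with `z` off the hyperplanes that contain it, and its support says which
those are. -/
theorem eq_of_mul_eq_of_supp_eq {x y z : 𝒜.Face} (hx : x * z = z) (hy : y * z = z)
    (h : x.supp = y.supp) : x = y := by
  ext H
  by_cases hH : x.sign H = 0
  · rw [hH, ((sign_eq_zero_congr h H).1 hH)]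
  · rw [← sign_eq_of_mul_eq hx hH,
      ← sign_eq_of_mul_eq hy ((sign_eq_zero_congr h H).not.1 hH)]

theorem exists_sign_of_supp_lt {x y : 𝒜.Face} (h : x.supp < y.supp) :
    ∃ H, x.sign H = 0 ∧ y.sign H ≠ 0 := by
  by_contra hc
  push Not at hc
  exact absurd ((supp_le_supp_iff y x).2 hc) (not_le_of_gt h)

/-- `x` is a facet of `y`. -/
def CoveredBy (x y : 𝒜.Face) : Prop :=
  x * y = y ∧ Module.finrank ℝ y.supp = Module.finrank ℝ x.supp + 1

namespace CoveredBy

variable {x y x' y' z : 𝒜.Face}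

theorem supp_lt (h : x.CoveredBy y) : x.supp < y.supp := by
  refine lt_of_le_of_ne (supp_le_of_mul_eq h.1) fun he => ?_
  have := h.2
  rw [he] at this
  omega

theorem exists_sign (h : x.CoveredBy y) : ∃ H, x.sign H = 0 ∧ y.sign H ≠ 0 :=
  exists_sign_of_supp_lt h.supp_lt

theorem supp_eq_inf (h : x.CoveredBy y) {H : 𝒜.hyperplanes} (hx : x.sign H = 0)
    (hy : y.sign H ≠ 0) : x.supp = y.supp ⊓ H.1 := by
  have h1 : y.supp ⊓ H.1 < y.supp := by
    refine lt_of_le_of_ne inf_le_left fun he => hy ?_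
    rw [sign_eq_zero_iff]
    exact inf_eq_left.1 he
  have := Submodule.finrank_lt_finrank_of_lt h1
  have h2 := h.2
  exact Submodule.eq_of_le_of_finrank_le
    (le_inf (supp_le_of_mul_eq h.1) ((x.sign_eq_zero_iff H).1 hx)) (by omega)

end CoveredBy

theorem coveredBy_of_lt_of_lt {x y z : 𝒜.Face} (h : x.supp < y.supp) (h' : y.supp < z.supp)
    (hd : Module.finrank ℝ z.supp = Module.finrank ℝ x.supp + 2)
    (hxy : x * y = y) (hyz : y * z = z) : x.CoveredBy y ∧ y.CoveredBy z := by
  have h1 := Submodule.finrank_lt_finrank_of_lt h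
  have h2 := Submodule.finrank_lt_finrank_of_lt h'
  exact ⟨⟨hxy, by omega⟩, ⟨hyz, by omega⟩⟩

/-- The chosen linear form comparing the orientations of two consecutive subspaces. -/
noncomputable def orientationForm (X Y : Submodule ℝ (Fin d → ℝ)) : (Fin d → ℝ) →ₗ[ℝ] ℝ :=
  (exists_incidence_forms (Fin d → ℝ)).choose X Y

theorem orientationForm_eq_zero_iff {X Y : Submodule ℝ (Fin d → ℝ)} (h : X ≤ Y)
    (hd : Module.finrank ℝ Y = Module.finrank ℝ X + 1) {v : Fin d → ℝ} (hv : v ∈ Y) :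
    orientationForm X Y v = 0 ↔ v ∈ X :=
  (exists_incidence_forms (Fin d → ℝ)).choose_spec.1 X Y h hd v hv

theorem orientationForm_mul_add {x y y' z : 𝒜.Face} (h : x.CoveredBy y) (h' : x.CoveredBy y')
    (hz : y.CoveredBy z) (hz' : y'.CoveredBy z) {v v' : Fin d → ℝ} (hv : v ∈ y.supp)
    (hv' : v' ∈ y'.supp) :
    orientationForm x.supp y.supp v * orientationForm y.supp z.supp v' +
      orientationForm x.supp y'.supp v' * orientationForm y'.supp z.supp v = 0 :=
  (exists_incidence_forms (Fin d → ℝ)).choose_spec.2 _ _ _ _ h.supp_lt.le h'.supp_lt.le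
    hz.supp_lt.le hz'.supp_lt.le h.2 h'.2 (by rw [hz.2, h.2]) v hv v' hv'

/-- Both forms restrict to `y.supp` with kernel `x.supp`, a hyperplane there, so they are
proportional. Orientations can therefore be compared through the sign at any one such `H`. -/
theorem CoveredBy.exists_orientationForm_eq {x y : 𝒜.Face} (h : x.CoveredBy y)
    {H : 𝒜.hyperplanes} (hx : x.sign H = 0) (hy : y.sign H ≠ 0) :
    ∃ c : ℝ, c ≠ 0 ∧ ∀ v ∈ y.supp, orientationForm x.supp y.supp v = c * 𝒜.form H v := by
  have hp : 𝒜.form H y.point ≠ 0 := fun h0 => hy ((form_point_eq_zero_iff y H).1 h0)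
  have hg : orientationForm x.supp y.supp y.point ≠ 0 := by
    rw [Ne, orientationForm_eq_zero_iff h.supp_lt.le h.2 y.point_mem_supp]
    exact fun hm => hp (form_eq_zero_of_mem_supp hm hx)
  refine ⟨orientationForm x.supp y.supp y.point / 𝒜.form H y.point, div_ne_zero hg hp, ?_⟩
  intro v hv
  have hm : v - (𝒜.form H v / 𝒜.form H y.point) • y.point ∈ x.supp := by
    rw [h.supp_eq_inf hx hy]
    refine ⟨sub_mem hv (Submodule.smul_mem _ _ y.point_mem_supp), ?_⟩
    change _ ∈ H.1
    rw [← 𝒜.ker_form H, LinearMap.mem_ker, map_sub, map_smul, smul_eq_mul,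
      div_mul_cancel₀ _ hp, sub_self]
  have := (orientationForm_eq_zero_iff h.supp_lt.le h.2
    (sub_mem hv (Submodule.smul_mem _ _ y.point_mem_supp))).2 hm
  rw [map_sub, map_smul, smul_eq_mul, sub_eq_zero] at this
  rw [this]
  ring

theorem CoveredBy.exists_form_eq {x y : 𝒜.Face} (h : x.CoveredBy y)
    {H K : 𝒜.hyperplanes} (hx : x.sign H = 0) (hy : y.sign H ≠ 0) (hxK : x.sign K = 0)
    (hyK : y.sign K ≠ 0) : ∃ c : ℝ, ∀ v ∈ y.supp, 𝒜.form K v = c * 𝒜.form H v := by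
  obtain ⟨a, _, ha⟩ := h.exists_orientationForm_eq hx hy
  obtain ⟨b, hb0, hb⟩ := h.exists_orientationForm_eq hxK hyK
  refine ⟨a / b, fun v hv => ?_⟩
  have := (hb v hv).symm.trans (ha v hv)
  field_simp
  linarith

/-- All hyperplanes through `x` but not `y` have proportional forms on `y.supp`, so the sign at one
of them determines the signs at the others. -/
theorem CoveredBy.eq_of_sign_eq {x y y' : 𝒜.Face} (h : x.CoveredBy y) (h' : x.CoveredBy y')
    (hs : y.supp = y'.supp) {H : 𝒜.hyperplanes} (hx : x.sign H = 0) (hy : y.sign H ≠ 0)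
    (hyy' : y.sign H = y'.sign H) : y = y' := by
  ext K
  by_cases hK : x.sign K = 0
  · by_cases hyK : y.sign K = 0
    · rw [hyK, (sign_eq_zero_congr hs K).1 hyK]
    · obtain ⟨c, hc⟩ := h.exists_form_eq hx hy hK hyK
      rw [← sign_form_point y, ← sign_form_point y', hc _ y.point_mem_supp,
        hc _ (hs ▸ y'.point_mem_supp), _root_.sign_mul, _root_.sign_mul, sign_form_point,
        sign_form_point, hyy']
  · rw [sign_eq_of_mul_eq h.1 hK, sign_eq_of_mul_eq h'.1 hK]

/-- The face `x * y.neg` is the reflection of `y` through its facet `x`. -/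
theorem CoveredBy.mul_neg {x y : 𝒜.Face} (h : x.CoveredBy y) : x.CoveredBy (x * y.neg) := by
  have hs : (x * y.neg).supp = y.supp := by
    rw [supp_mul_of_le (by rw [supp_neg]; exact h.supp_lt.le), supp_neg]
  exact ⟨by rw [← mul_assoc, mul_self], by rw [hs, h.2]⟩

theorem CoveredBy.supp_mul_neg {x y : 𝒜.Face} (h : x.CoveredBy y) :
    (x * y.neg).supp = y.supp := by
  rw [supp_mul_of_le (by rw [supp_neg]; exact h.supp_lt.le), supp_neg]

/-- The incidence numbers of the cell decomposition. -/
noncomputable def incidence (x y : 𝒜.Face) : ℤ :=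
  open Classical in
  if x.CoveredBy y then (SignType.sign (orientationForm x.supp y.supp y.point) : ℤ) else 0

theorem incidence_of_not {x y : 𝒜.Face} (h : ¬ x.CoveredBy y) : incidence x y = 0 := if_neg h

theorem coveredBy_of_incidence_ne_zero {x y : 𝒜.Face} (h : incidence x y ≠ 0) :
    x.CoveredBy y := by
  by_contra h'
  exact h (incidence_of_not h')

/-- The orientation form is on `y.supp` a multiple of the form of one hyperplane, whose sign is
constant on `y`; so any point of `y` gives the same incidence number. -/
theorem CoveredBy.incidence_eq {x y : 𝒜.Face} (h : x.CoveredBy y) {v : Fin d → ℝ}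
    (hv : ∀ H, SignType.sign (𝒜.form H v) = y.sign H) :
    incidence x y = (SignType.sign (orientationForm x.supp y.supp v) : ℤ) := by
  obtain ⟨H, hx, hy⟩ := h.exists_sign
  obtain ⟨c, _, hc⟩ := h.exists_orientationForm_eq hx hy
  have hvm : v ∈ y.supp := by
    rw [mem_supp_iff]
    intro K hK
    rwa [← hv K, _root_.sign_eq_zero_iff] at hK
  rw [incidence, if_pos h, hc _ hvm, hc _ y.point_mem_supp, _root_.sign_mul, _root_.sign_mul,
    sign_form_point, hv]

theorem CoveredBy.incidence_mul_sign {x y x' y' : 𝒜.Face} (h : x.CoveredBy y)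
    (h' : x'.CoveredBy y') (hx : x.supp = x'.supp) (hy : y.supp = y'.supp)
    {H : 𝒜.hyperplanes} (hxH : x.sign H = 0) (hyH : y.sign H ≠ 0) :
    incidence x y * (y'.sign H : ℤ) = incidence x' y' * (y.sign H : ℤ) := by
  obtain ⟨c, _, hc⟩ := h.exists_orientationForm_eq hxH hyH
  rw [incidence, incidence, if_pos h, if_pos h', ← hx, ← hy, hc _ y.point_mem_supp,
    hc _ (hy ▸ y'.point_mem_supp), _root_.sign_mul, _root_.sign_mul, sign_form_point,
    sign_form_point]
  push_cast
  ring

theorem CoveredBy.incidence_mul_self {x y : 𝒜.Face} (h : x.CoveredBy y) :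
    incidence x y * incidence x y = 1 := by
  obtain ⟨H, hx, hy⟩ := h.exists_sign
  obtain ⟨c, hc0, hc⟩ := h.exists_orientationForm_eq hx hy
  have : SignType.sign (orientationForm x.supp y.supp y.point) ≠ 0 := by
    rw [hc _ y.point_mem_supp, _root_.sign_mul, sign_form_point]
    exact mul_ne_zero (by rwa [Ne, _root_.sign_eq_zero_iff]) hy
  rw [incidence, if_pos h]
  generalize SignType.sign (orientationForm x.supp y.supp y.point) = s at this
  revert s
  decide

theorem CoveredBy.incidence_congr {x y x' y' : 𝒜.Face} (h : x.CoveredBy y)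
    (h' : x'.CoveredBy y') (hx : x.supp = x'.supp) (hy : y.supp = y'.supp)
    {H : 𝒜.hyperplanes} (hxH : x.sign H = 0) (hyH : y.sign H ≠ 0)
    (he : y.sign H = y'.sign H) : incidence x y = incidence x' y' := by
  have := h.incidence_mul_sign h' hx hy hxH hyH
  rw [← he] at this
  refine mul_right_cancel₀ ?_ this
  generalize y.sign H = s at hyH
  revert s
  decide

theorem CoveredBy.incidence_neg {x y x' y' : 𝒜.Face} (h : x.CoveredBy y)
    (h' : x'.CoveredBy y') (hx : x.supp = x'.supp) (hy : y.supp = y'.supp)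
    {H : 𝒜.hyperplanes} (hxH : x.sign H = 0) (hyH : y.sign H ≠ 0)
    (he : y'.sign H = -y.sign H) : incidence x' y' = -incidence x y := by
  have := h.incidence_mul_sign h' hx hy hxH hyH
  rw [he] at this
  have h0 : (y.sign H : ℤ) ≠ 0 := by
    generalize y.sign H = s at hyH
    revert s
    decide
  have h1 : ((-y.sign H : SignType) : ℤ) = -(y.sign H : ℤ) := by
    generalize y.sign H = s
    revert s
    decide
  rw [h1] at this
  refine mul_right_cancel₀ h0 ?_
  linarith

theorem CoveredBy.mul_neg_mul_neg {x y : 𝒜.Face} (h : x.CoveredBy y) :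
    x * (x * y.neg).neg = y := by
  conv_rhs => rw [← h.1]
  ext K
  simp only [sign_mul, sign_neg]
  split_ifs <;> simp

theorem CoveredBy.sign_mul_neg {x y : 𝒜.Face} {H : 𝒜.hyperplanes}
    (hx : x.sign H = 0) : (x * y.neg).sign H = -y.sign H := by
  rw [sign_mul, if_neg (not_not.2 hx), sign_neg]

theorem CoveredBy.mul_neg_ne {x y : 𝒜.Face} (h : x.CoveredBy y) : x * y.neg ≠ y := by
  obtain ⟨H, hx, hy⟩ := h.exists_sign
  intro he
  have := congrArg (fun f => f.sign H) he
  simp only [CoveredBy.sign_mul_neg hx] at this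
  generalize y.sign H = s at this hy
  revert s
  decide

theorem CoveredBy.incidence_mul_neg {x y : 𝒜.Face} (h : x.CoveredBy y) :
    incidence x (x * y.neg) = -incidence x y := by
  obtain ⟨H, hx, hy⟩ := h.exists_sign
  exact h.incidence_neg h.mul_neg rfl h.supp_mul_neg.symm hx hy (CoveredBy.sign_mul_neg hx)

/-- Reflection through `x` is a fixed-point-free involution on the cofaces of `x`, and it reverses
the incidence number. -/
theorem sum_incidence_eq_zero (x : 𝒜.Face) (s : Finset 𝒜.Face)
    (hs : ∀ y ∈ s, x.CoveredBy y → x * y.neg ∈ s) : ∑ y ∈ s, incidence x y = 0 := by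
  classical
  have : ∑ y ∈ s, incidence x y = ∑ y ∈ s with x.CoveredBy y, incidence x y := by
    rw [Finset.sum_filter]
    refine Finset.sum_congr rfl fun y _ => ?_
    split_ifs with h
    exacts [rfl, incidence_of_not h]
  rw [this]
  refine Finset.sum_involution (fun y _ => x * y.neg) ?_ ?_ ?_ ?_
  · intro y hy
    rw [(Finset.mem_filter.1 hy).2.incidence_mul_neg, add_neg_cancel]
  · intro y hy _
    exact (Finset.mem_filter.1 hy).2.mul_neg_ne
  · intro y hy
    obtain ⟨h1, h2⟩ := Finset.mem_filter.1 hy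
    exact Finset.mem_filter.2 ⟨hs y h1 h2, h2.mul_neg⟩
  · intro y hy
    exact (Finset.mem_filter.1 hy).2.mul_neg_mul_neg

end Face

end CentralArrangement

/-! ### Intervals of length two, and compatibility of incidence with the action -/

namespace CentralArrangement

namespace Face

variable {d : ℕ} {𝒜 : CentralArrangement d}

theorem CoveredBy.eq_of_sign_eq_zero {y y' z : 𝒜.Face} (hz : y.CoveredBy z)
    (hz' : y'.CoveredBy z) {H : 𝒜.hyperplanes} (hy : y.sign H = 0)
    (hy' : y'.sign H = 0) (hzH : z.sign H ≠ 0) : y = y' := by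
  refine eq_of_mul_eq_of_supp_eq hz.1 hz'.1 ?_
  rw [hz.supp_eq_inf hy hzH, hz'.supp_eq_inf hy' hzH]

/-- Move from a point of `z` away from `y` until the first wall that contains `x` but not `y`.
Multiplying the face reached by `x` on the left gives the second face between `x` and `z`. -/
theorem CoveredBy.exists_other {x y z : 𝒜.Face} (h : x.CoveredBy y) (hz : y.CoveredBy z) :
    ∃ y', x.CoveredBy y' ∧ y'.CoveredBy z ∧ y' ≠ y := by
  classical
  obtain ⟨H₁, hy₁, hz₁⟩ := hz.exists_sign
  have hx₁ := sign_left_eq_zero h.1 hy₁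
  let T : Finset 𝒜.hyperplanes := {H | x.sign H = 0 ∧ y.sign H ≠ 0}
  have hT : T.Nonempty := by
    obtain ⟨H, hH⟩ := h.exists_sign
    exact ⟨H, by simpa [T] using hH⟩
  -- The line `z.point - t • y.point` meets `H` at time `t = r H`; the minimum over `T` is the first
  -- wall.
  let r : 𝒜.hyperplanes → ℝ := fun H => 𝒜.form H z.point / 𝒜.form H y.point
  obtain ⟨H₀, hH₀, hmin⟩ := T.exists_min_image r hT
  obtain ⟨hx₀, hy₀⟩ : x.sign H₀ = 0 ∧ y.sign H₀ ≠ 0 := by simpa [T] using hH₀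
  let p : Fin d → ℝ := z.point - r H₀ • y.point
  have hp : ∀ H, x.sign H = 0 → y.sign H ≠ 0 →
      𝒜.form H p = 𝒜.form H y.point * (r H - r H₀) := by
    intro H _ hyH
    have : 𝒜.form H y.point ≠ 0 := (form_point_eq_zero_iff y H).not.2 hyH
    simp only [p, r, map_sub, map_smul, smul_eq_mul]
    field_simp
  have hp' : ∀ H, y.sign H = 0 → 𝒜.form H p = 𝒜.form H z.point := by
    intro H hH
    simp [p, (form_point_eq_zero_iff y H).2 hH]
  have hy'0 : ∀ H, x.sign H = 0 →
      (x * ofPoint 𝒜 p).sign H = SignType.sign (𝒜.form H p) := by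
    intro H hH
    rw [sign_mul, if_neg (not_not.2 hH), sign_ofPoint]
  have hle : (x * ofPoint 𝒜 p) * z = z := by
    rw [mul_eq_right_iff]
    intro H hH
    by_cases hxH : x.sign H = 0
    · rw [hy'0 H hxH] at hH ⊢
      by_cases hyH : y.sign H = 0
      · rw [hp' H hyH, sign_form_point]
      · rw [hp H hxH hyH] at hH ⊢
        have hr : r H₀ ≤ r H := hmin H (by simp [T, hxH, hyH])
        rcases hr.eq_or_lt with he | hlt
        · simp [he] at hH
        · rw [_root_.sign_mul, sign_form_point, sign_pos (sub_pos.2 hlt), mul_one,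
            sign_eq_of_mul_eq hz.1 hyH]
    · rw [sign_mul, if_pos hxH, sign_eq_of_mul_eq hz.1 (by rwa [sign_eq_of_mul_eq h.1 hxH]),
        sign_eq_of_mul_eq h.1 hxH]
  have hxle : x * (x * ofPoint 𝒜 p) = x * ofPoint 𝒜 p := by rw [← mul_assoc, mul_self]
  have hs₁ : (x * ofPoint 𝒜 p).sign H₁ ≠ 0 := by
    rw [hy'0 H₁ hx₁, hp' H₁ hy₁, sign_form_point]
    exact hz₁
  have hs₀ : (x * ofPoint 𝒜 p).sign H₀ = 0 := by
    rw [hy'0 H₀ hx₀, hp H₀ hx₀ hy₀, sub_self, mul_zero, sign_zero]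
  have lt_of : ∀ {a b : 𝒜.Face} {H : 𝒜.hyperplanes}, a * b = b → a.sign H = 0 → b.sign H ≠ 0 →
      a.supp < b.supp := fun {a b H} hab ha hb =>
    lt_of_le_of_ne (supp_le_of_mul_eq hab) fun he => hb ((sign_eq_zero_congr he H).1 ha)
  obtain ⟨h1, h2⟩ := coveredBy_of_lt_of_lt (lt_of hxle hx₁ hs₁)
    (lt_of hle hs₀ (by rwa [sign_eq_of_mul_eq hz.1 hy₀])) (by rw [hz.2, h.2]) hxle hle
  exact ⟨_, h1, h2, fun he => hs₁ (by rw [he, hy₁])⟩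

theorem sign_mul_sign_pos {x y z : 𝒜.Face} (hx : x * z = z) (hy : y * z = z)
    {H : 𝒜.hyperplanes} (hxH : x.sign H ≠ 0) (hyH : y.sign H ≠ 0) :
    0 < 𝒜.form H x.point * 𝒜.form H y.point := by
  rw [← sign_eq_one_iff, _root_.sign_mul, sign_form_point, sign_form_point,
    ← sign_eq_of_mul_eq hx hxH, sign_eq_of_mul_eq hy hyH]
  generalize y.sign H = s at hyH
  revert s
  decide

/-- Three middle faces would be three rays bounding one planar cone modulo `x.supp`. The forms of
`H₂` and `H₃` are proportional on `y₁.supp`; comparing them at a point of `y₁` and at the vector `u`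
gives factors of opposite sign. -/
theorem CoveredBy.not_three {x y₁ y₂ y₃ z : 𝒜.Face} (h₁ : x.CoveredBy y₁) (h₂ : x.CoveredBy y₂)
    (h₃ : x.CoveredBy y₃) (hz₁ : y₁.CoveredBy z) (hz₂ : y₂.CoveredBy z) (hz₃ : y₃.CoveredBy z)
    (h₁₂ : y₁ ≠ y₂) (h₁₃ : y₁ ≠ y₃) (h₂₃ : y₂ ≠ y₃) : False := by
  obtain ⟨H₁, hy₁, hzH₁⟩ := hz₁.exists_sign
  obtain ⟨H₂, hy₂, hzH₂⟩ := hz₂.exists_sign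
  obtain ⟨H₃, hy₃, hzH₃⟩ := hz₃.exists_sign
  have n12 : y₁.sign H₂ ≠ 0 := fun h => h₁₂ (hz₁.eq_of_sign_eq_zero hz₂ h hy₂ hzH₂)
  have n13 : y₁.sign H₃ ≠ 0 := fun h => h₁₃ (hz₁.eq_of_sign_eq_zero hz₃ h hy₃ hzH₃)
  have n21 : y₂.sign H₁ ≠ 0 := fun h => h₁₂ (hz₁.eq_of_sign_eq_zero hz₂ hy₁ h hzH₁)
  have n31 : y₃.sign H₁ ≠ 0 := fun h => h₁₃ (hz₁.eq_of_sign_eq_zero hz₃ hy₁ h hzH₁)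
  have n23 : y₂.sign H₃ ≠ 0 := fun h => h₂₃ (hz₂.eq_of_sign_eq_zero hz₃ h hy₃ hzH₃)
  have n32 : y₃.sign H₂ ≠ 0 := fun h => h₂₃ (hz₂.eq_of_sign_eq_zero hz₃ hy₂ h hzH₂)
  obtain ⟨c, hc⟩ := h₁.exists_form_eq (sign_left_eq_zero h₂.1 hy₂) n12
    (sign_left_eq_zero h₃.1 hy₃) n13
  -- The coefficients make the form of `H₁` vanish, which puts `u` in `y₁.supp`.
  let u : Fin d → ℝ := 𝒜.form H₁ y₃.point • y₂.point - 𝒜.form H₁ y₂.point • y₃.point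
  have hu : u ∈ y₁.supp := by
    rw [hz₁.supp_eq_inf hy₁ hzH₁]
    refine ⟨sub_mem (Submodule.smul_mem _ _ (hz₂.supp_lt.le y₂.point_mem_supp))
      (Submodule.smul_mem _ _ (hz₃.supp_lt.le y₃.point_mem_supp)), ?_⟩
    change u ∈ H₁.1
    rw [← 𝒜.ker_form H₁, LinearMap.mem_ker]
    simp only [u, map_sub, map_smul, smul_eq_mul]
    ring
  have e2 : 𝒜.form H₂ u = -(𝒜.form H₁ y₂.point * 𝒜.form H₂ y₃.point) := by
    simp [u, (form_point_eq_zero_iff y₂ H₂).2 hy₂]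
  have e3 : 𝒜.form H₃ u = 𝒜.form H₁ y₃.point * 𝒜.form H₃ y₂.point := by
    simp [u, (form_point_eq_zero_iff y₃ H₃).2 hy₃]
  have hcu := hc u hu
  have hcv := hc _ y₁.point_mem_supp
  rw [e2, e3] at hcu
  have p1 := sign_mul_sign_pos hz₂.1 hz₃.1 n21 n31
  have p2 := sign_mul_sign_pos hz₁.1 hz₃.1 n12 n32
  have p3 := sign_mul_sign_pos hz₁.1 hz₂.1 n13 n23
  rw [hcv] at p3
  set a2 := 𝒜.form H₁ y₂.point
  set a3 := 𝒜.form H₁ y₃.point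
  set b1 := 𝒜.form H₂ y₁.point
  set b3 := 𝒜.form H₂ y₃.point
  set f2 := 𝒜.form H₃ y₂.point
  have q1 : 0 < c * (a2 * b3) * (f2 * a2) * b1 ^ 2 := by
    have hb1 : b1 ≠ 0 := (form_point_eq_zero_iff y₁ H₂).not.2 n12
    have ha2 : a2 ≠ 0 := (form_point_eq_zero_iff y₂ H₁).not.2 n21
    have : c * (a2 * b3) * (f2 * a2) * b1 ^ 2 = (c * b1 * f2) * (b1 * b3) * a2 ^ 2 := by ring
    rw [this]
    positivity
  have q2 : c * (a2 * b3) * (f2 * a2) * b1 ^ 2 = -((a2 * a3) * (f2 * b1) ^ 2) := by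
    have : c * (a2 * b3) = -(a3 * f2) := by linarith
    rw [this]
    ring
  have q3 : 0 ≤ (a2 * a3) * (f2 * b1) ^ 2 := by positivity
  linarith

/-- The sum of a point of `y` and a point of `y'` lies in `z`. Tested there, the form of `y` in `z`
sees only the point of `y'` and conversely, so the anticommutation relation of the orientation forms
applies. -/
theorem incidence_mul_incidence_add {x y y' z : 𝒜.Face} (h : x.CoveredBy y)
    (h' : x.CoveredBy y') (hz : y.CoveredBy z) (hz' : y'.CoveredBy z) (hne : y ≠ y') :
    incidence x y * incidence y z + incidence x y' * incidence y' z = 0 := by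
  have hw : ∀ H, SignType.sign (𝒜.form H (y.point + y'.point)) = z.sign H := by
    intro H
    rw [map_add]
    by_cases hy : y.sign H = 0
    · rw [(form_point_eq_zero_iff y H).2 hy, zero_add, sign_form_point]
      by_cases hy' : y'.sign H = 0
      · rw [hy']
        by_contra h0
        exact hne (hz.eq_of_sign_eq_zero hz' hy hy' (Ne.symm h0))
      · exact (sign_eq_of_mul_eq hz'.1 hy').symm
    · by_cases hy' : y'.sign H = 0
      · rw [(form_point_eq_zero_iff y' H).2 hy', add_zero, sign_form_point,
          sign_eq_of_mul_eq hz.1 hy]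
      · have e1 := sign_form_point y H
        have e2 := sign_form_point y' H
        rw [← sign_eq_of_mul_eq hz.1 hy] at e1
        rw [← sign_eq_of_mul_eq hz'.1 hy'] at e2
        have h0 : z.sign H ≠ 0 := by rwa [sign_eq_of_mul_eq hz.1 hy]
        rcases hs : z.sign H with _ | _ | _
        · exact absurd hs h0
        · rw [hs] at e1 e2
          have := sign_eq_neg_one_iff.1 e1
          have := sign_eq_neg_one_iff.1 e2
          exact sign_eq_neg_one_iff.2 (by linarith)
        · rw [hs] at e1 e2
          have := sign_eq_one_iff.1 e1
          have := sign_eq_one_iff.1 e2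
          exact sign_eq_one_iff.2 (by linarith)
  have e1 : orientationForm y.supp z.supp (y.point + y'.point) =
      orientationForm y.supp z.supp y'.point := by
    rw [map_add, (orientationForm_eq_zero_iff hz.supp_lt.le hz.2
      (hz.supp_lt.le y.point_mem_supp)).2 y.point_mem_supp, zero_add]
  have e2 : orientationForm y'.supp z.supp (y.point + y'.point) =
      orientationForm y'.supp z.supp y.point := by
    rw [map_add, (orientationForm_eq_zero_iff hz'.supp_lt.le hz'.2
      (hz'.supp_lt.le y'.point_mem_supp)).2 y'.point_mem_supp, add_zero]
  rw [hz.incidence_eq hw, hz'.incidence_eq hw, h.incidence_eq (sign_form_point y),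
    h'.incidence_eq (sign_form_point y'), e1, e2, ← SignType.coe_mul, ← SignType.coe_mul,
    ← _root_.sign_mul, ← _root_.sign_mul, eq_neg_of_add_eq_zero_left
      (orientationForm_mul_add h h' hz hz' y.point_mem_supp y'.point_mem_supp), Left.sign_neg]
  have key : ∀ s : SignType, ((-s : SignType) : ℤ) + (s : ℤ) = 0 := by decide
  exact key _

/-- An interval of length two has exactly two middle faces, and their contributions cancel. -/
theorem sum_incidence_mul_incidence (x z : 𝒜.Face) :
    ∑ y, incidence x y * incidence y z = 0 := by
  by_cases hex : ∃ y, x.CoveredBy y ∧ y.CoveredBy z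
  · obtain ⟨y, h, hz⟩ := hex
    obtain ⟨y', h', hz', hne⟩ := h.exists_other hz
    rw [← Finset.sum_subset (Finset.subset_univ {y, y'}), Finset.sum_pair hne.symm]
    · exact incidence_mul_incidence_add h h' hz hz' hne.symm
    · intro w _ hw
      rw [Finset.mem_insert, Finset.mem_singleton, not_or] at hw
      by_contra h0
      exact h.not_three h' (coveredBy_of_incidence_ne_zero (left_ne_zero_of_mul h0)) hz hz'
        (coveredBy_of_incidence_ne_zero (right_ne_zero_of_mul h0)) hne.symm (Ne.symm hw.1)
        (Ne.symm hw.2)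
  · refine Finset.sum_eq_zero fun y _ => ?_
    by_contra h0
    exact hex ⟨y, coveredBy_of_incidence_ne_zero (left_ne_zero_of_mul h0),
      coveredBy_of_incidence_ne_zero (right_ne_zero_of_mul h0)⟩

theorem CoveredBy.mul_left {x y w : 𝒜.Face} (h : x.CoveredBy y) (hw : w.supp ≤ x.supp) :
    (w * x).CoveredBy (w * y) := by
  refine ⟨?_, ?_⟩
  · rw [← mul_assoc, mul_mul_self, mul_assoc, h.1]
  · rw [supp_mul_of_le hw, supp_mul_of_le (hw.trans h.supp_lt.le), h.2]

theorem CoveredBy.incidence_mul_left {x y w : 𝒜.Face} (h : x.CoveredBy y)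
    (hw : w.supp ≤ x.supp) : incidence (w * x) (w * y) = incidence x y := by
  obtain ⟨H, hx, hy⟩ := h.exists_sign
  refine (h.incidence_congr (h.mul_left hw) (supp_mul_of_le hw).symm
    (supp_mul_of_le (hw.trans h.supp_lt.le)).symm hx hy ?_).symm
  rw [sign_mul, if_neg]
  exact not_not.2 ((supp_le_supp_iff _ _).1 hw H hx)

theorem mul_mul_eq_of_supp_le {w x : 𝒜.Face} (hw : w.supp ≤ x.supp) (y : 𝒜.Face) :
    x * (w * y) = x * y := by
  rw [← mul_assoc, mul_eq_left_iff.2 hw]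

/-- The hyperplanes through `x` but not `y` have proportional forms on `y.supp`, which contains `w`.
Since `w` lies off one of them it lies off all, so `w * x` absorbs both `y` and its opposite. -/
theorem CoveredBy.mul_mul_neg {w x y : 𝒜.Face} (h : x.CoveredBy y) (hw : w.supp ≤ y.supp)
    (hwx : ¬ w.supp ≤ x.supp) : w * (x * y.neg) = w * y := by
  have hyw : y.supp ≤ (w * x).supp := by
    obtain ⟨H, hx, hw'⟩ : ∃ H, x.sign H = 0 ∧ w.sign H ≠ 0 := by
      by_contra hc
      push Not at hc
      exact hwx ((supp_le_supp_iff _ _).2 hc)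
    rw [supp_le_supp_iff]
    intro K hK
    by_contra hyK
    rw [sign_mul] at hK
    have hwK : w.sign K = 0 := by
      by_contra h0
      rw [if_pos h0] at hK
      exact h0 hK
    rw [if_neg (not_not.2 hwK)] at hK
    have hyH : y.sign H ≠ 0 := fun h0 => hw' ((supp_le_supp_iff _ _).1 hw H h0)
    obtain ⟨c, hc⟩ := h.exists_form_eq hK hyK hx hyH
    have := hc _ (hw w.point_mem_supp)
    rw [(form_point_eq_zero_iff w K).2 hwK, mul_zero, form_point_eq_zero_iff] at this
    exact hw' this
  calc w * (x * y.neg) = w * x * y.neg := (mul_assoc _ _ _).symm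
    _ = w * x := mul_eq_left_iff.2 (by rwa [supp_neg])
    _ = w * x * y := (mul_eq_left_iff.2 hyw).symm
    _ = w * y := by rw [mul_assoc, h.1]

open Classical in
/-- The coboundary commutes with the action of the faces. -/
theorem sum_incidence_of_mul_eq (w x y' : 𝒜.Face) :
    ∑ y with w.supp ≤ y.supp ∧ w * y = y', incidence x y =
      if w.supp ≤ x.supp then incidence (w * x) y' else 0 := by
  split_ifs with hw
  · by_cases hc : (w * x).CoveredBy y'
    · have hy' : w * (x * y') = y' := by rw [← mul_assoc, hc.1]
      have h1 : (w * x).supp = x.supp := supp_mul_of_le hw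
      have hcx : x.CoveredBy (x * y') := by
        refine ⟨by rw [← mul_assoc, mul_self], ?_⟩
        rw [supp_mul_of_le (h1 ▸ hc.supp_lt.le), hc.2, h1]
      rw [Finset.sum_eq_single (x * y'), ← hcx.incidence_mul_left hw, hy']
      · intro y hy hne
        obtain ⟨_, _, h2⟩ := Finset.mem_filter.1 hy
        refine incidence_of_not fun hc => hne ?_
        rw [← h2, mul_mul_eq_of_supp_le hw, hc.1]
      · exact fun hn => absurd (Finset.mem_filter.2
          ⟨Finset.mem_univ _, hw.trans hcx.supp_lt.le, hy'⟩) hn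
    · rw [incidence_of_not hc]
      refine Finset.sum_eq_zero fun y hy => incidence_of_not fun hxy => hc ?_
      obtain ⟨_, _, rfl⟩ := Finset.mem_filter.1 hy
      exact hxy.mul_left hw
  -- Here `w` does not distinguish a coface of `x` from its reflection through `x`, so the sum
  -- cancels in pairs.
  · refine sum_incidence_eq_zero x _ fun y hy hc => ?_
    obtain ⟨_, h1, h2⟩ := Finset.mem_filter.1 hy
    refine Finset.mem_filter.2 ⟨Finset.mem_univ _, ?_, ?_⟩
    · rw [hc.supp_mul_neg]; exact h1
    · rw [hc.mul_mul_neg h1 hw, h2]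

end Face

end CentralArrangement

/-! ### Convex sets of faces and their slices by a hyperplane -/

namespace CentralArrangement

namespace Face

variable {d : ℕ} {𝒜 : CentralArrangement d}

theorem ofPoint_point (x : 𝒜.Face) : ofPoint 𝒜 x.point = x := by
  ext H
  rw [sign_ofPoint, sign_form_point]

/-- A set of faces that behaves like the set of faces meeting a relatively open convex set. -/
structure IsConvex (U : Set 𝒜.Face) : Prop where
  mul_mem : ∀ x ∈ U, ∀ t ∈ U, ∀ y : 𝒜.Face, y.supp ≤ t.supp → x * y ∈ U
  mem_of_between : ∀ x ∈ U, ∀ z ∈ U, ∀ y, x * y = y → y * z = z → y ∈ U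
  combination_mem : ∀ v w : Fin d → ℝ, ofPoint 𝒜 v ∈ U → ofPoint 𝒜 w ∈ U → ∀ a b : ℝ, 0 < a →
    0 < b → ofPoint 𝒜 (a • v + b • w) ∈ U

/-- The part of a set of faces with a given sign at a hyperplane. -/
def slice (U : Set 𝒜.Face) (H : 𝒜.hyperplanes) (s : SignType) : Set 𝒜.Face :=
  {x | x ∈ U ∧ x.sign H = s}

/-- The faces of `U` of the largest support. -/
def IsTop (U : Set 𝒜.Face) (x : 𝒜.Face) : Prop := x ∈ U ∧ ∀ y ∈ U, y.supp ≤ x.supp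

theorem isConvex_supp_le (z : 𝒜.Face) : IsConvex {x : 𝒜.Face | x.supp ≤ z.supp} where
  mul_mem x hx t ht y hy := (supp_mul_le_iff _ _ _).2 ⟨hx, hy.trans ht⟩
  mem_of_between x _ z hz y _ hyz := (supp_le_of_mul_eq hyz).trans hz
  combination_mem v w hv hw a b _ _ := by
    rw [Set.mem_ofPred_eq, supp_le_supp_iff] at *
    intro H hH
    have h1 := hv H hH
    have h2 := hw H hH
    rw [sign_ofPoint, _root_.sign_eq_zero_iff] at *
    simp [h1, h2]

theorem sign_combination {a b : ℝ} (ha : 0 < a) (hb : 0 < b) {r t : ℝ}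
    (h : SignType.sign r = SignType.sign t) :
    SignType.sign (a * r + b * t) = SignType.sign r := by
  rcases lt_trichotomy r 0 with hr | rfl | hr
  · have ht : t < 0 := sign_eq_neg_one_iff.1 (by rw [← h, _root_.sign_neg hr])
    rw [_root_.sign_neg hr, sign_eq_neg_one_iff]
    have := mul_neg_of_pos_of_neg ha hr
    have := mul_neg_of_pos_of_neg hb ht
    linarith
  · have ht : t = 0 := _root_.sign_eq_zero_iff.1 (by rw [← h, sign_zero])
    simp [ht]
  · have ht : 0 < t := sign_eq_one_iff.1 (by rw [← h, sign_pos hr])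
    rw [sign_pos hr, sign_eq_one_iff]
    positivity

namespace IsConvex

variable {U : Set 𝒜.Face}

theorem slice (hU : IsConvex U) (H : 𝒜.hyperplanes) (s : SignType) : IsConvex (slice U H s) where
  mul_mem x hx t ht y hy := by
    refine ⟨hU.mul_mem x hx.1 t ht.1 y hy, ?_⟩
    rw [sign_mul]
    split_ifs with h
    · exact hx.2
    · rw [not_not] at h
      have hs : s = 0 := by rw [← hx.2, h]
      rw [hs]
      exact (supp_le_supp_iff _ _).1 hy H (ht.2.trans hs)
  mem_of_between x hx z hz y hxy hyz := by
    refine ⟨hU.mem_of_between x hx.1 z hz.1 y hxy hyz, ?_⟩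
    by_cases h : x.sign H = 0
    · rw [sign_left_eq_zero hyz (by rw [hz.2, ← hx.2, h]), ← hx.2, h]
    · rw [sign_eq_of_mul_eq hxy h, hx.2]
  combination_mem v w hv hw a b ha hb := by
    refine ⟨hU.combination_mem v w hv.1 hw.1 a b ha hb, ?_⟩
    have h1 := hv.2
    have h2 := hw.2
    rw [sign_ofPoint] at h1 h2 ⊢
    rw [map_add, map_smul, map_smul, smul_eq_mul, smul_eq_mul, sign_combination ha hb, h1]
    rw [h1, h2]

theorem mul_mem' (hU : IsConvex U) {x y : 𝒜.Face} (hx : x ∈ U) (hy : y ∈ U) : x * y ∈ U :=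
  hU.mul_mem x hx y hy y le_rfl

theorem mul_neg_mem (hU : IsConvex U) {x y : 𝒜.Face} (hx : x ∈ U) (hy : y ∈ U) : x * y.neg ∈ U :=
  hU.mul_mem x hx y hy y.neg (supp_neg y).le

theorem exists_isTop (hU : IsConvex U) (hne : U.Nonempty) : ∃ x, IsTop U x := by
  obtain ⟨x, hx, hmax⟩ := (Set.toFinite U).exists_maximalFor
    (fun x : 𝒜.Face => Module.finrank ℝ x.supp) U hne
  refine ⟨x, hx, fun y hy => ?_⟩
  have h1 := hU.mul_mem' hx hy
  have h2 := left_supp_le_supp_mul x y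
  have h3 := Submodule.eq_of_le_of_finrank_le h2
    (hmax h1 (Submodule.finrank_mono h2))
  rw [h3]
  exact right_supp_le_supp_mul x y

/-- The segment between points on the two sides crosses `H`; the values of the form at the endpoints
supply the positive coefficients of the crossing point. -/
theorem exists_slice_zero (hU : IsConvex U) {H : 𝒜.hyperplanes}
    (hp : (Face.slice U H 1).Nonempty) (hn : (Face.slice U H (-1)).Nonempty) :
    (Face.slice U H 0).Nonempty := by
  obtain ⟨x, hx, hx1⟩ := hp
  obtain ⟨y, hy, hy1⟩ := hn
  rw [← sign_form_point, sign_eq_one_iff] at hx1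
  rw [← sign_form_point, sign_eq_neg_one_iff] at hy1
  refine ⟨_, hU.combination_mem x.point y.point (by rwa [ofPoint_point]) (by rwa [ofPoint_point])
    (-𝒜.form H y.point) (𝒜.form H x.point) (by linarith) hx1, ?_⟩
  rw [sign_ofPoint, _root_.sign_eq_zero_iff]
  simp only [map_add, map_smul, smul_eq_mul]
  ring

theorem slice_nonempty (hU : IsConvex U) {H : 𝒜.hyperplanes} {x y : 𝒜.Face} (hx : x ∈ U)
    (hy : y ∈ U) (hxy : x.sign H ≠ y.sign H) (s : SignType) : (Face.slice U H s).Nonempty := by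
  have key : (Face.slice U H 1).Nonempty ∧ (Face.slice U H (-1)).Nonempty := by
    have main : ∀ t : 𝒜.Face, t ∈ U → t.sign H ≠ 0 → ∀ u ∈ U, u.sign H ≠ t.sign H →
        ∃ u ∈ U, u.sign H = -t.sign H := by
      intro t ht ht0 u hu hut
      by_cases hu0 : u.sign H = 0
      · exact ⟨_, hU.mul_neg_mem hu ht, CoveredBy.sign_mul_neg hu0⟩
      · refine ⟨u, hu, ?_⟩
        generalize u.sign H = a at hut hu0
        generalize t.sign H = b at hut ht0
        revert a b
        decide
    obtain ⟨t, ht, ht0, u, hu, hut⟩ : ∃ t ∈ U, t.sign H ≠ 0 ∧ ∃ u ∈ U, u.sign H = -t.sign H := by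
      by_cases hx0 : x.sign H = 0
      · exact ⟨y, hy, fun h => hxy (hx0.trans h.symm), main y hy
          (fun h => hxy (hx0.trans h.symm)) x hx hxy⟩
      · exact ⟨x, hx, hx0, main x hx hx0 y hy hxy.symm⟩
    rcases h : t.sign H with _ | _ | _
    · exact absurd h ht0
    · exact ⟨⟨u, hu, by rw [hut, h]; rfl⟩, ⟨t, ht, h⟩⟩
    · exact ⟨⟨t, ht, h⟩, ⟨u, hu, by rw [hut, h]; rfl⟩⟩
  rcases s with _ | _ | _
  exacts [hU.exists_slice_zero key.1 key.2, key.2, key.1]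

end IsConvex

namespace IsTop

variable {U : Set 𝒜.Face} {H : 𝒜.hyperplanes}

theorem supp_eq {x y : 𝒜.Face} (hx : IsTop U x) (hy : IsTop U y) : x.supp = y.supp :=
  le_antisymm (hy.2 _ hx.1) (hx.2 _ hy.1)

theorem of_supp_eq {x y : 𝒜.Face} (hx : IsTop U x) (hy : y ∈ U) (h : x.supp = y.supp) :
    IsTop U y :=
  ⟨hy, fun z hz => h ▸ hx.2 z hz⟩

/-- A nonzero slice is open in `U`: right multiplication of one of its faces by any face of `U`
stays inside it. Hence it reaches the full dimension of `U`. -/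
theorem slice_iff (hU : IsConvex U) {s : SignType} (hs : s ≠ 0) {x : 𝒜.Face} :
    IsTop (slice U H s) x ↔ IsTop U x ∧ x.sign H = s := by
  constructor
  · rintro ⟨⟨hx, hxs⟩, h⟩
    refine ⟨⟨hx, fun y hy => ?_⟩, hxs⟩
    refine (right_supp_le_supp_mul x y).trans (h _ ⟨hU.mul_mem' hx hy, ?_⟩)
    rw [sign_mul, if_pos (by rwa [hxs]), hxs]
  · rintro ⟨⟨hx, h⟩, hxs⟩
    exact ⟨⟨hx, hxs⟩, fun y hy => h y hy.1⟩

/-- Any vector of `t.supp ⊓ H`, even one whose face is outside `U`, is a direction in which `x` can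
be thickened within the slice. This is why `mul_mem` bounds only the support of the right factor. -/
theorem supp_slice_zero (hU : IsConvex U) {x t : 𝒜.Face} (hx : IsTop (slice U H 0) x)
    (ht : IsTop U t) : x.supp = t.supp ⊓ H.1 := by
  apply le_antisymm
  · exact le_inf (ht.2 x hx.1.1) ((x.sign_eq_zero_iff H).1 hx.1.2)
  · rintro v ⟨hv, hvH⟩
    have hvH' : 𝒜.form H v = 0 := by
      change v ∈ H.1 at hvH
      rwa [← 𝒜.ker_form H, LinearMap.mem_ker] at hvH
    have hle : (ofPoint 𝒜 v).supp ≤ t.supp := by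
      rw [supp_le_supp_iff]
      intro K hK
      rw [sign_ofPoint, form_eq_zero_of_mem_supp hv hK, sign_zero]
    have hmem : x * ofPoint 𝒜 v ∈ slice U H 0 := by
      refine ⟨hU.mul_mem x hx.1.1 t ht.1 _ hle, ?_⟩
      rw [sign_mul, if_neg (not_not.2 hx.1.2), sign_ofPoint, hvH', sign_zero]
    refine ((right_supp_le_supp_mul _ _).trans (hx.2 _ hmem)) ?_
    rw [mem_supp_iff]
    intro K hK
    rwa [sign_ofPoint, _root_.sign_eq_zero_iff] at hK

theorem finrank_slice_zero (hU : IsConvex U) {x t : 𝒜.Face} (hx : IsTop (slice U H 0) x)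
    (ht : IsTop U t) (htH : t.sign H ≠ 0) :
    Module.finrank ℝ t.supp = Module.finrank ℝ x.supp + 1 := by
  rw [supp_slice_zero hU hx ht]
  have h1 := Submodule.finrank_sup_add_finrank_inf_eq t.supp H.1
  have h2 : H.1 < t.supp ⊔ H.1 := by
    refine lt_of_le_of_ne le_sup_right fun he => htH ?_
    rw [sign_eq_zero_iff]
    exact sup_eq_right.1 he.symm
  have h3 := Submodule.finrank_lt_finrank_of_lt h2
  have h4 := 𝒜.finrank_add_one H.1 H.2
  have h5 := Submodule.finrank_le (t.supp ⊔ H.1)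
  rw [Module.finrank_fin_fun] at h5
  omega

/-- The cover of a top face of the slice at `H` on a given side of `H`. -/
theorem coveredBy_mul (hU : IsConvex U) {x t : 𝒜.Face} (hx : IsTop (slice U H 0) x)
    (ht : IsTop U t) (htH : t.sign H ≠ 0) : x.CoveredBy (x * t) :=
  ⟨by rw [← mul_assoc, mul_self], by
    rw [supp_mul_of_le (ht.2 x hx.1.1), finrank_slice_zero hU hx ht htH]⟩

theorem mul_top (hU : IsConvex U) {x t : 𝒜.Face} (hx : x ∈ U) (ht : IsTop U t) :
    IsTop U (x * t) :=
  ht.of_supp_eq (hU.mul_mem' hx ht.1) (supp_mul_of_le (ht.2 x hx)).symm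

open Classical in
-- For a top face `x` of the zero slice, the only top coface on the side of `t` is `x * t`; for
-- dimension reasons the other faces of the slice have none. The incidence number depends only on
-- the supports and the side, hence not on `x`.
theorem sum_incidence_slice (hU : IsConvex U) {x₀ t : 𝒜.Face} (hx₀ : IsTop (slice U H 0) x₀)
    (ht : IsTop U t) (htH : t.sign H ≠ 0) {x : 𝒜.Face} (hx : x ∈ slice U H 0) :
    ∑ y with IsTop (slice U H (t.sign H)) y, incidence x y =
      if IsTop (slice U H 0) x then incidence x₀ (x₀ * t) else 0 := by
  have hH : ∀ x : 𝒜.Face, x.sign H = 0 → (x * t).sign H = t.sign H := fun x h => by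
    rw [sign_mul, if_neg (not_not.2 h)]
  split_ifs with hxt
  · have hc := coveredBy_mul hU hxt ht htH
    have hc₀ := coveredBy_mul hU hx₀ ht htH
    have hs : (x * t).supp = (x₀ * t).supp :=
      (mul_top hU hx.1 ht).supp_eq (mul_top hU hx₀.1.1 ht)
    rw [Finset.sum_eq_single (x * t)]
    · exact hc.incidence_congr hc₀ (hxt.supp_eq hx₀) hs hx.2 (by rwa [hH x hx.2])
        (by rw [hH x hx.2, hH x₀ hx₀.1.2])
    · intro y hy hne
      have hy' := (slice_iff hU htH).1 (Finset.mem_filter.1 hy).2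
      refine incidence_of_not fun hxy => hne ?_
      exact hxy.eq_of_sign_eq hc (hy'.1.supp_eq (mul_top hU hx.1 ht)) hx.2 (by rwa [hy'.2])
        (by rw [hy'.2, hH x hx.2])
    · exact fun hn => absurd (Finset.mem_filter.2 ⟨Finset.mem_univ _, (slice_iff hU htH).2
        ⟨mul_top hU hx.1 ht, hH x hx.2⟩⟩) hn
  · refine Finset.sum_eq_zero fun y hy => incidence_of_not fun hxy => hxt ?_
    have hy' := (slice_iff hU htH).1 (Finset.mem_filter.1 hy).2
    have h1 := finrank_slice_zero hU hx₀ ht htH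
    have h2 := hxy.2
    rw [hy'.1.supp_eq ht] at h2
    refine hx₀.of_supp_eq hx (Submodule.eq_of_le_of_finrank_le (hx₀.2 x hx) ?_).symm
    omega

end IsTop

/-! ### The coboundary and the sum over top faces -/

section Coboundary

variable (k : Type*) [CommRing k]

/-- The coboundary of the cell decomposition. -/
noncomputable def coboundary : (𝒜.Face → k) →ₗ[k] (𝒜.Face → k) :=
  Matrix.mulVecLin (Matrix.of fun y x => (incidence x y : k))

open Classical in
/-- The sum of the coefficients at the top faces of `U`. -/
noncomputable def topSum (U : Set 𝒜.Face) : (𝒜.Face → k) →ₗ[k] k :=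
  ∑ y with IsTop U y, LinearMap.proj y

variable {k}

theorem coboundary_apply (z : 𝒜.Face → k) (y : 𝒜.Face) :
    coboundary k z y = ∑ x, (incidence x y : k) * z x := rfl

open Classical in
theorem topSum_apply (U : Set 𝒜.Face) (z : 𝒜.Face → k) :
    topSum k U z = ∑ y with IsTop U y, z y := by
  simp [topSum]

theorem coboundary_congr {z z' : 𝒜.Face → k} {y : 𝒜.Face}
    (h : ∀ x, x.CoveredBy y → z x = z' x) : coboundary k z y = coboundary k z' y := by
  rw [coboundary_apply, coboundary_apply]
  refine Finset.sum_congr rfl fun x _ => ?_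
  by_cases hc : x.CoveredBy y
  · rw [h x hc]
  · rw [incidence_of_not hc, Int.cast_zero, zero_mul, zero_mul]

theorem topSum_congr {U : Set 𝒜.Face} {z z' : 𝒜.Face → k} (h : ∀ x, IsTop U x → z x = z' x) :
    topSum k U z = topSum k U z' := by
  classical
  rw [topSum_apply, topSum_apply]
  exact Finset.sum_congr rfl fun x hx => h x (Finset.mem_filter.1 hx).2

theorem coboundary_coboundary (z : 𝒜.Face → k) : coboundary k (coboundary k z) = 0 := by
  funext y
  simp only [coboundary_apply, Finset.mul_sum]
  rw [Finset.sum_comm]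
  refine Finset.sum_eq_zero fun v _ => ?_
  have := congrArg (Int.cast : ℤ → k) (sum_incidence_mul_incidence v y)
  push_cast at this
  calc ∑ x, (incidence x y : k) * ((incidence v x : k) * z v)
      = (∑ x, (incidence v x : k) * (incidence x y : k)) * z v := by
        rw [Finset.sum_mul]
        exact Finset.sum_congr rfl fun x _ => by ring
    _ = 0 := by rw [this, zero_mul]

open Classical in
theorem topSum_coboundary (U : Set 𝒜.Face) (z : 𝒜.Face → k) :
    topSum k U (coboundary k z) =
      ∑ x, ((∑ y with IsTop U y, incidence x y : ℤ) : k) * z x := by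
  rw [topSum_apply]
  simp only [coboundary_apply]
  rw [Finset.sum_comm]
  refine Finset.sum_congr rfl fun x _ => ?_
  rw [Int.cast_sum, Finset.sum_mul]

/-- The top cofaces of a face of `U` come in opposite pairs inside `U`. -/
theorem IsConvex.topSum_coboundary_eq_zero {U : Set 𝒜.Face} (hU : IsConvex U) {z : 𝒜.Face → k}
    (hz : ∀ x, x ∉ U → z x = 0) : topSum k U (coboundary k z) = 0 := by
  classical
  rw [topSum_coboundary]
  refine Finset.sum_eq_zero fun x _ => ?_
  by_cases hx : x ∈ U
  · rw [sum_incidence_eq_zero, Int.cast_zero, zero_mul]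
    intro y hy hc
    have hy' := (Finset.mem_filter.1 hy).2
    exact Finset.mem_filter.2 ⟨Finset.mem_univ _,
      hy'.of_supp_eq (hU.mul_neg_mem hx hy'.1) hc.supp_mul_neg.symm⟩
  · rw [hz x hx, mul_zero]

/-- Faces between two members of `U` are in `U`, so truncating to `U` between the two coboundaries
discards nothing that is visible from `U`. -/
theorem IsConvex.coboundary_indicator_coboundary {U : Set 𝒜.Face} (hU : IsConvex U)
    {z : 𝒜.Face → k} (hz : ∀ x, x ∉ U → z x = 0) {y : 𝒜.Face} (hy : y ∈ U) :
    coboundary k (U.indicator (coboundary k z)) y = 0 := by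
  refine Eq.trans ?_ (congrFun (coboundary_coboundary z) y)
  refine coboundary_congr fun x hx => ?_
  by_cases hxU : x ∈ U
  · rw [Set.indicator_of_mem hxU]
  · rw [Set.indicator_of_notMem hxU, coboundary_apply]
    refine (Finset.sum_eq_zero fun v _ => ?_).symm
    by_cases hv : v ∈ U
    · rw [incidence_of_not, Int.cast_zero, zero_mul]
      exact fun hvx => hxU (hU.mem_of_between v hv y hy x hvx.1 hx.1)
    · rw [hz v hv, mul_zero]

end Coboundary

end Face

end CentralArrangement

/-! ### Acyclicity of convex sets of faces -/

namespace CentralArrangement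

namespace Face

variable {d : ℕ} {𝒜 : CentralArrangement d} {k : Type*} [CommRing k]

/-- Acyclicity of the augmented cochain complex of the faces in `U`. -/
def Acyclic (k : Type*) [CommRing k] (U : Set 𝒜.Face) : Prop :=
  ∀ z : 𝒜.Face → k, (∀ x, x ∉ U → z x = 0) → (∀ y ∈ U, coboundary k z y = 0) →
    topSum k U z = 0 → ∃ w : 𝒜.Face → k, (∀ x, x ∉ U → w x = 0) ∧
      ∀ y ∈ U, coboundary k w y = z y

theorem acyclic_of_subsingleton {U : Set 𝒜.Face} (h : U.Subsingleton) : Acyclic k U := by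
  classical
  intro z hz _ ht
  refine ⟨0, fun _ _ => rfl, fun y hy => ?_⟩
  rw [topSum_apply, Finset.sum_eq_single y] at ht
  · rw [ht, map_zero]
    rfl
  · intro x hx hxy
    exact absurd (h (Finset.mem_filter.1 hx).2.1 hy) hxy
  · intro hn
    exact absurd (Finset.mem_filter.2 ⟨Finset.mem_univ _, hy, fun x hx => (h hx hy ▸ le_rfl)⟩) hn

/-- Restriction to a nonzero slice of a cochain that vanishes on the zero slice. -/
theorem coboundary_slice_eq {U : Set 𝒜.Face} {H : 𝒜.hyperplanes} {s : SignType}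
    {z : 𝒜.Face → k} (hz : ∀ x, x ∉ U → z x = 0) {y : 𝒜.Face} (hy : y ∈ slice U H s) :
    coboundary k z y = coboundary k ((slice U H s).indicator z) y +
      if s = 0 then 0 else coboundary k ((slice U H 0).indicator z) y := by
  split_ifs with hs
  · rw [add_zero]
    refine coboundary_congr fun x hx => ?_
    by_cases hxU : x ∈ slice U H s
    · rw [Set.indicator_of_mem hxU]
    · rw [Set.indicator_of_notMem hxU]
      refine hz x fun h => hxU ⟨h, ?_⟩
      rw [hs, sign_left_eq_zero hx.1 (hy.2.trans hs)]
  · rw [← Pi.add_apply, ← map_add]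
    refine coboundary_congr fun x hx => ?_
    by_cases hxU : x ∈ U
    · by_cases h0 : x.sign H = 0
      · have h1 : x ∉ slice U H s := fun h => hs (h.2.symm.trans h0)
        have h2 : x ∈ slice U H 0 := ⟨hxU, h0⟩
        simp [h1, h2]
      · have h1 : x ∈ slice U H s := ⟨hxU, by rw [← sign_eq_of_mul_eq hx.1 h0, hy.2]⟩
        have h2 : x ∉ slice U H 0 := fun h => h0 h.2
        simp [h1, h2]
    · have h1 : x ∉ slice U H s := fun h => hxU h.1
      have h2 : x ∉ slice U H 0 := fun h => hxU h.1
      simp [h1, h2, hz x hxU]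

/-- This is the connecting map from the zero slice to one side on top classes: it is multiplication
by a single sign. -/
theorem topSum_slice_coboundary {U : Set 𝒜.Face} (hU : IsConvex U) {H : 𝒜.hyperplanes}
    {x₀ t : 𝒜.Face} (hx₀ : IsTop (slice U H 0) x₀) (ht : IsTop U t) (htH : t.sign H ≠ 0)
    {z : 𝒜.Face → k} (hz : ∀ x, x ∉ slice U H 0 → z x = 0) :
    topSum k (slice U H (t.sign H)) (coboundary k z) =
      (incidence x₀ (x₀ * t) : k) * topSum k (slice U H 0) z := by
  classical
  rw [topSum_coboundary, topSum_apply, Finset.mul_sum, Finset.sum_filter]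
  refine Finset.sum_congr rfl fun x _ => ?_
  by_cases hx : x ∈ slice U H 0
  · rw [IsTop.sum_incidence_slice hU hx₀ ht htH hx]
    split_ifs <;> simp
  · rw [hz x hx, mul_zero, if_neg fun h => hx h.1]

theorem topSum_eq_add {U : Set 𝒜.Face} (hU : IsConvex U) {H : 𝒜.hyperplanes} {t : 𝒜.Face}
    (ht : IsTop U t) (htH : t.sign H ≠ 0) (z : 𝒜.Face → k) :
    topSum k U z = topSum k (slice U H 1) z + topSum k (slice U H (-1)) z := by
  classical
  rw [topSum_apply, topSum_apply, topSum_apply, Finset.sum_filter, Finset.sum_filter,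
    Finset.sum_filter, ← Finset.sum_add_distrib]
  refine Finset.sum_congr rfl fun y _ => ?_
  rw [IsTop.slice_iff hU (by decide), IsTop.slice_iff hU (by decide)]
  by_cases hy : IsTop U y
  · have hyH : y.sign H ≠ 0 := fun h => htH ((sign_eq_zero_congr (hy.supp_eq ht) H).1 h)
    rcases h : y.sign H with _ | _ | _
    · exact absurd h hyH
    · simp [hy]
    · simp [hy]
  · simp [hy]

/-- This is the long exact sequence of the closed slice on `H` and its two open sides, written out
on cochains: solve on `H`, move top mass between the sides until each has sum zero, then solve on
each side separately. Coboundaries pass from `H` to the sides but never back, nor from one side to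
the other. -/
theorem acyclic_of_slices {U : Set 𝒜.Face} (hU : IsConvex U) {H : 𝒜.hyperplanes}
    (hne : ∀ s, (slice U H s).Nonempty) (h : ∀ s, Acyclic k (slice U H s)) : Acyclic k U := by
  classical
  intro z hz hDz htz
  obtain ⟨x₀, hx₀⟩ := (hU.slice H 0).exists_isTop (hne 0)
  obtain ⟨t, ht⟩ := (hU.slice H 1).exists_isTop (hne 1)
  obtain ⟨ht, htH⟩ := (IsTop.slice_iff hU (by decide)).1 ht
  have htH0 : t.sign H ≠ 0 := by rw [htH]; decide
  have hsub : ∀ {s x}, x ∉ U → x ∉ slice U H s := fun hx hx' => hx hx'.1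
  set c : k := (incidence x₀ (x₀ * t) : k) with hc
  have hcc : c * c = 1 := by
    rw [hc, ← Int.cast_mul, (IsTop.coveredBy_mul hU hx₀ ht htH0).incidence_mul_self, Int.cast_one]
  have hc0 : ∀ {z : 𝒜.Face → k}, (∀ x, x ∉ slice U H 0 → z x = 0) →
      topSum k (slice U H 1) (coboundary k z) = c * topSum k (slice U H 0) z := by
    intro z hz
    rw [← htH]
    exact topSum_slice_coboundary hU hx₀ ht htH0 hz
  have ind : ∀ (s : SignType) (z : 𝒜.Face → k), ∀ x, x ∉ slice U H s →
      (slice U H s).indicator z x = 0 := fun s z x hx => Set.indicator_of_notMem hx _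
  -- On the positive side the coboundaries of the parts of `z` on `H` and on that side cancel. The
  -- second has top sum zero, so the first does too, and `c` is invertible.
  have hz0 : topSum k (slice U H 0) ((slice U H 0).indicator z) = 0 := by
    have h1 := hc0 (ind 0 z)
    have h2 : topSum k (slice U H 1) (coboundary k ((slice U H 0).indicator z)) =
        topSum k (slice U H 1) (-coboundary k ((slice U H 1).indicator z)) := by
      refine topSum_congr fun y hy => ?_
      have := coboundary_slice_eq hz hy.1
      rw [hDz y hy.1.1, if_neg (by decide)] at this
      rw [Pi.neg_apply]
      exact (neg_eq_of_add_eq_zero_right this.symm).symm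
    rw [h2, map_neg, (hU.slice H 1).topSum_coboundary_eq_zero (ind 1 z), neg_zero] at h1
    calc _ = c * (c * topSum k (slice U H 0) ((slice U H 0).indicator z)) := by
          rw [← mul_assoc, hcc, one_mul]
      _ = 0 := by rw [← h1, mul_zero]
  obtain ⟨w₀, hw₀, hDw₀⟩ := h 0 _ (ind 0 z) (fun y hy => by
    have := coboundary_slice_eq hz hy
    rw [if_pos rfl, add_zero, hDz y hy.1] at this
    exact this.symm) hz0
  have hw₀U : ∀ x, x ∉ U → w₀ x = 0 := fun x hx => hw₀ x (hsub hx)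
  -- A unit mass on one top face of the slice on `H`: it is closed there, and its coboundary has top
  -- sum `c` on the positive side.
  let δ : 𝒜.Face → k := Pi.single x₀ 1
  have hδ : ∀ x, x ∉ slice U H 0 → δ x = 0 := fun x hx => by
    refine Pi.single_eq_of_ne (fun h => hx ?_) _
    rw [h]; exact hx₀.1
  have hδU : ∀ x, x ∉ U → δ x = 0 := fun x hx => hδ x (hsub hx)
  have hDδ : ∀ y ∈ slice U H 0, coboundary k δ y = 0 := by
    intro y hy
    rw [coboundary_apply]
    refine Finset.sum_eq_zero fun x _ => ?_
    by_cases hx : x = x₀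
    · rw [incidence_of_not, Int.cast_zero, zero_mul]
      intro hxy
      rw [hx] at hxy
      exact absurd (hx₀.2 y hy) (not_le_of_gt hxy.supp_lt)
    · rw [show δ x = 0 from Pi.single_eq_of_ne hx _, mul_zero]
  have htδ : topSum k (slice U H 0) δ = 1 := by
    rw [topSum_apply, Finset.sum_eq_single x₀]
    · exact Pi.single_eq_same _ _
    · intro x _ hx
      exact Pi.single_eq_of_ne hx _
    · exact fun hn => absurd (Finset.mem_filter.2 ⟨Finset.mem_univ _, hx₀⟩) hn
  let z₁ : 𝒜.Face → k := z - U.indicator (coboundary k w₀)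
  -- As `c * c = 1`, this multiple of `δ` makes the top sum of `z₂` vanish on the positive side; the
  -- negative side follows because the total is zero.
  let a : k := topSum k (slice U H 1) z₁ * c
  let z₂ : 𝒜.Face → k := z - U.indicator (coboundary k (w₀ + a • δ))
  have hz₂_eq : ∀ y ∈ U, z₂ y = z y - coboundary k w₀ y - a * coboundary k δ y := by
    intro y hy
    simp only [z₂, Pi.sub_apply, Set.indicator_of_mem hy, map_add, map_smul, Pi.add_apply,
      Pi.smul_apply, smul_eq_mul]
    ring
  have hsum : ∀ x, x ∉ U → (w₀ + a • δ) x = 0 := fun x hx => by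
    simp [hw₀U x hx, hδU x hx]
  have hz₂ : ∀ x, x ∉ U → z₂ x = 0 := fun x hx => by
    simp [z₂, hz x hx, hx]
  have hDz₂ : ∀ y ∈ U, coboundary k z₂ y = 0 := by
    intro y hy
    simp only [z₂, map_sub, Pi.sub_apply]
    rw [hDz y hy, hU.coboundary_indicator_coboundary hsum hy, sub_zero]
  have hz₂0 : ∀ y ∈ slice U H 0, z₂ y = 0 := by
    intro y hy
    rw [hz₂_eq y hy.1, hDw₀ y hy, hDδ y hy, Set.indicator_of_mem hy, sub_self, mul_zero, sub_zero]
  have ht₂ : topSum k U z₂ = 0 := by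
    have : topSum k U z₂ = topSum k U (z - coboundary k (w₀ + a • δ)) := by
      refine topSum_congr fun y hy => ?_
      simp [z₂, Set.indicator_of_mem hy.1]
    rw [this, map_sub, htz, hU.topSum_coboundary_eq_zero hsum, sub_zero]
  have ht₂p : topSum k (slice U H 1) z₂ = 0 := by
    have : topSum k (slice U H 1) z₂ = topSum k (slice U H 1) (z₁ - a • coboundary k δ) := by
      refine topSum_congr fun y hy => ?_
      rw [hz₂_eq y hy.1.1]
      simp [z₁, Set.indicator_of_mem hy.1.1]
    rw [this, map_sub, map_smul, hc0 hδ, htδ, smul_eq_mul, mul_one, mul_assoc, hcc, mul_one,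
      sub_self]
  have ht₂n : topSum k (slice U H (-1)) z₂ = 0 := by
    have := topSum_eq_add hU ht htH0 z₂
    rwa [ht₂, ht₂p, zero_add, eq_comm] at this
  have hzero : (slice U H 0).indicator z₂ = 0 := by
    funext y
    by_cases hy : y ∈ slice U H 0
    · rw [Set.indicator_of_mem hy, hz₂0 y hy]; rfl
    · rw [Set.indicator_of_notMem hy]; rfl
  have solve : ∀ s : SignType, s ≠ 0 → topSum k (slice U H s) z₂ = 0 →
      ∃ w : 𝒜.Face → k, (∀ x, x ∉ slice U H s → w x = 0) ∧
        ∀ y ∈ slice U H s, coboundary k w y = z₂ y := by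
    intro s hs hts
    obtain ⟨w, hw, hDw⟩ := h s _ (ind s z₂) (fun y hy => by
      have := coboundary_slice_eq hz₂ hy
      rw [hDz₂ y hy.1, hzero, map_zero, Pi.zero_apply, ite_self, add_zero] at this
      exact this.symm) (by
        rw [← hts]
        exact topSum_congr fun x hx => Set.indicator_of_mem hx.1 _)
    exact ⟨w, hw, fun y hy => by rw [hDw y hy, Set.indicator_of_mem hy]⟩
  obtain ⟨w₁, hw₁, hDw₁⟩ := solve 1 (by decide) ht₂p
  obtain ⟨w₂, hw₂, hDw₂⟩ := solve (-1) (by decide) ht₂n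
  have vanish : ∀ {s : SignType} {w : 𝒜.Face → k}, s ≠ 0 → (∀ x, x ∉ slice U H s → w x = 0) →
      ∀ y, y.sign H ≠ s → coboundary k w y = 0 := by
    intro s w hs hw y hy
    rw [coboundary_apply]
    refine Finset.sum_eq_zero fun x _ => ?_
    by_cases hx : x ∈ slice U H s
    · rw [incidence_of_not, Int.cast_zero, zero_mul]
      intro hxy
      exact hy (by rw [sign_eq_of_mul_eq hxy.1 (by rwa [hx.2]), hx.2])
    · rw [hw x hx, mul_zero]
  refine ⟨w₀ + a • δ + w₁ + w₂, fun x hx => ?_, fun y hy => ?_⟩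
  · rw [Pi.add_apply, Pi.add_apply, hsum x hx, hw₁ x (hsub hx), hw₂ x (hsub hx)]
    simp
  · have h2 := hz₂_eq y hy
    simp only [map_add, map_smul, Pi.add_apply, Pi.smul_apply, smul_eq_mul]
    rcases hs : y.sign H with _ | _ | _
    · rw [vanish (by decide) hw₁ y (by rw [hs]; decide),
        vanish (by decide) hw₂ y (by rw [hs]; decide)]
      rw [hz₂0 y ⟨hy, hs⟩] at h2
      linear_combination h2
    · rw [vanish (by decide) hw₁ y (by rw [hs]; decide), hDw₂ y ⟨hy, hs⟩, h2]
      ring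
    · rw [vanish (by decide) hw₂ y (by rw [hs]; decide), hDw₁ y ⟨hy, hs⟩, h2]
      ring

/-- Induction on the number of hyperplanes at which the sign is not constant on `U`. Slicing along
one of them removes it from the count; when none is left, `U` has at most one face. -/
theorem IsConvex.acyclic {U : Set 𝒜.Face} (hU : IsConvex U) : Acyclic k U := by
  classical
  let cut : Set 𝒜.Face → Finset 𝒜.hyperplanes := fun U =>
    {H | ∃ x ∈ U, ∃ y ∈ U, x.sign H ≠ y.sign H}
  induction hn : (cut U).card using Nat.strong_induction_on generalizing U with
  | _ n ih =>
    by_cases hcut : ∃ H, H ∈ cut U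
    · obtain ⟨H, hH⟩ := hcut
      obtain ⟨x, hx, y, hy, hxy⟩ : ∃ x ∈ U, ∃ y ∈ U, x.sign H ≠ y.sign H := by
        simpa [cut] using hH
      refine acyclic_of_slices hU (hU.slice_nonempty hx hy hxy) fun s =>
        ih _ ?_ (hU.slice H s) rfl
      rw [← hn]
      refine Finset.card_lt_card (Finset.ssubset_iff_of_subset ?_ |>.2 ⟨H, hH, ?_⟩)
      · intro K hK
        obtain ⟨x, hx, y, hy, hxy⟩ := (Finset.mem_filter.1 hK).2
        exact Finset.mem_filter.2 ⟨Finset.mem_univ _, x, hx.1, y, hy.1, hxy⟩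
      · intro hK
        obtain ⟨x, hx, y, hy, hxy⟩ := (Finset.mem_filter.1 hK).2
        exact hxy (hx.2.trans hy.2.symm)
    · refine acyclic_of_subsingleton fun x hx y hy => ?_
      ext H
      by_contra hne
      exact hcut ⟨H, Finset.mem_filter.2 ⟨Finset.mem_univ _, x, hx, y, hy, hne⟩⟩

end Face

end CentralArrangement

/-! ### Cell modules and their projectivity -/

namespace CentralArrangement

open Face

variable {d : ℕ} (𝒜 : CentralArrangement d) (k : Type u) [Field k]

/-- The vector space spanned by the faces whose support satisfies `p`. -/
def CellModule (p : Submodule ℝ (Fin d → ℝ) → Prop) : Type u := {x : 𝒜.Face // p x.supp} →₀ k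

namespace CellModule

variable {𝒜 k} {p : Submodule ℝ (Fin d → ℝ) → Prop}

noncomputable instance : Fintype {x : 𝒜.Face // p x.supp} := Fintype.ofFinite _

noncomputable instance : AddCommGroup (𝒜.CellModule k p) :=
  inferInstanceAs (AddCommGroup ({x : 𝒜.Face // p x.supp} →₀ k))

noncomputable instance : Module k (𝒜.CellModule k p) :=
  inferInstanceAs (Module k ({x : 𝒜.Face // p x.supp} →₀ k))

/-- The basis vector of a face. -/
noncomputable def cell (x : {x : 𝒜.Face // p x.supp}) : 𝒜.CellModule k p := Finsupp.single x (1 : k)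

/-- The coefficient of a face. -/
noncomputable def coeff (x : {x : 𝒜.Face // p x.supp}) : 𝒜.CellModule k p →ₗ[k] k :=
  Finsupp.lapply x

@[ext]
theorem ext {m m' : 𝒜.CellModule k p} (h : ∀ x, coeff x m = coeff x m') : m = m' :=
  Finsupp.ext h

open Classical in
theorem coeff_cell (x y : {x : 𝒜.Face // p x.supp}) :
    coeff y (cell x : 𝒜.CellModule k p) = if x = y then 1 else 0 :=
  Finsupp.single_apply

theorem eq_sum (m : 𝒜.CellModule k p) : m = ∑ x, coeff x m • cell x := by
  classical
  ext y
  rw [map_sum]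
  simp only [map_smul, coeff_cell, smul_eq_mul, mul_ite, mul_one, mul_zero]
  simp

theorem linearMap_ext {M : Type*} [AddCommGroup M] [Module k M] {f g : 𝒜.CellModule k p →ₗ[k] M}
    (h : ∀ x, f (cell x) = g (cell x)) : f = g :=
  LinearMap.ext fun m => by rw [eq_sum m]; simp [h]

/-- The linear map with given values on the basis. -/
noncomputable def liftₗ {M : Type*} [AddCommGroup M] [Module k M]
    (f : {x : 𝒜.Face // p x.supp} → M) : 𝒜.CellModule k p →ₗ[k] M :=
  Finsupp.linearCombination k f

theorem liftₗ_cell {M : Type*} [AddCommGroup M] [Module k M]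
    (f : {x : 𝒜.Face // p x.supp} → M) (x : {x : 𝒜.Face // p x.supp}) :
    liftₗ f (cell x : 𝒜.CellModule k p) = f x := by
  exact (Finsupp.linearCombination_single k 1 x).trans (one_smul k (f x))

/-- The product of a face with a cell, when the support does not grow. -/
def mulCell (w : 𝒜.Face) (x : {x : 𝒜.Face // p x.supp}) (h : w.supp ≤ x.1.supp) :
    {x : 𝒜.Face // p x.supp} :=
  ⟨w * x.1, by rw [supp_mul_of_le h]; exact x.2⟩

open Classical in
/-- The product of a face with a basis vector. -/
noncomputable def actCell (w : 𝒜.Face) (x : {x : 𝒜.Face // p x.supp}) : 𝒜.CellModule k p :=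
  if h : w.supp ≤ x.1.supp then cell (mulCell w x h) else 0

/-- The action of the faces on the space of cells. -/
noncomputable def action : 𝒜.Face →* Module.End k (𝒜.CellModule k p) where
  toFun w := liftₗ (actCell w)
  map_one' := by
    refine linearMap_ext fun x => ?_
    rw [liftₗ_cell, actCell, dif_pos (supp_one_le x.1)]
    exact congrArg cell (Subtype.ext (one_mul x.1))
  map_mul' w v := by
    refine linearMap_ext fun x => ?_
    rw [Module.End.mul_apply, liftₗ_cell, liftₗ_cell]
    by_cases hv : v.supp ≤ x.1.supp
    · have e : actCell v x = (cell (mulCell v x hv) : 𝒜.CellModule k p) := dif_pos hv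
      rw [e, liftₗ_cell]
      have hs : (v * x.1).supp = x.1.supp := supp_mul_of_le hv
      by_cases hw : w.supp ≤ x.1.supp
      · rw [actCell, actCell, dif_pos ((supp_mul_le_iff _ _ _).2 ⟨hw, hv⟩), dif_pos]
        · exact congrArg cell (Subtype.ext (mul_assoc _ _ _))
        · exact hw.trans hs.ge
      · rw [actCell, actCell, dif_neg fun h => hw ((supp_mul_le_iff _ _ _).1 h).1, dif_neg]
        exact fun h => hw (h.trans hs.le)
    · have e : actCell v x = (0 : 𝒜.CellModule k p) := dif_neg hv
      rw [e, map_zero, actCell, dif_neg fun h => hv ((supp_mul_le_iff _ _ _).1 h).2]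

noncomputable instance : Module (𝒜.FaceAlgebra k) (𝒜.CellModule k p) :=
  Module.compHom _ (MonoidAlgebra.lift k (Module.End k (𝒜.CellModule k p)) 𝒜.Face action).toRingHom

theorem smul_def (a : 𝒜.FaceAlgebra k) (m : 𝒜.CellModule k p) :
    a • m = MonoidAlgebra.lift k (Module.End k (𝒜.CellModule k p)) 𝒜.Face action a m := rfl

instance : IsScalarTower k (𝒜.FaceAlgebra k) (𝒜.CellModule k p) where
  smul_assoc c a m := by rw [smul_def, smul_def, map_smul, LinearMap.smul_apply]

theorem single_smul (w : 𝒜.Face) (m : 𝒜.CellModule k p) :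
    (MonoidAlgebra.single w (1 : k) : 𝒜.FaceAlgebra k) • m = action w m := by
  rw [smul_def, MonoidAlgebra.lift_single, one_smul]

open Classical in
theorem single_smul_cell (w : 𝒜.Face) (x : {x : 𝒜.Face // p x.supp}) :
    (MonoidAlgebra.single w (1 : k) : 𝒜.FaceAlgebra k) • (cell x : 𝒜.CellModule k p) =
      if h : w.supp ≤ x.1.supp then cell (mulCell w x h) else 0 := by
  rw [single_smul]
  exact liftₗ_cell _ _

open Classical in
theorem coeff_single_smul (w : 𝒜.Face) (m : 𝒜.CellModule k p) (y : {x : 𝒜.Face // p x.supp}) :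
    coeff y ((MonoidAlgebra.single w (1 : k) : 𝒜.FaceAlgebra k) • m) =
      ∑ x with w.supp ≤ x.1.supp ∧ w * x.1 = y.1, coeff x m := by
  rw [single_smul]
  conv_lhs => rw [eq_sum m]
  rw [map_sum, map_sum, Finset.sum_filter]
  refine Finset.sum_congr rfl fun x _ => ?_
  rw [map_smul, map_smul, ← single_smul, single_smul_cell]
  by_cases h : w.supp ≤ x.1.supp
  · rw [dif_pos h, coeff_cell]
    simp [h, mulCell, Subtype.ext_iff]
  · simp [h]

variable {M : Type*} [AddCommGroup M] [Module k M] [Module (𝒜.FaceAlgebra k) M]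
  [IsScalarTower k (𝒜.FaceAlgebra k) M]

open Classical in
/-- The module homomorphism with given values on the basis. -/
noncomputable def lift (f : {x : 𝒜.Face // p x.supp} → M)
    (hf : ∀ (w : 𝒜.Face) (x : {x : 𝒜.Face // p x.supp}),
      (MonoidAlgebra.single w (1 : k) : 𝒜.FaceAlgebra k) • f x =
        if h : w.supp ≤ x.1.supp then f (mulCell w x h) else 0) :
    𝒜.CellModule k p →ₗ[𝒜.FaceAlgebra k] M :=
  MonoidAlgebra.equivariantOfLinearOfComm (liftₗ f) fun w m => by
    rw [eq_sum m, Finset.smul_sum, map_sum, map_sum, Finset.smul_sum]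
    refine Finset.sum_congr rfl fun x _ => ?_
    rw [smul_comm (MonoidAlgebra.single w (1 : k)) (coeff x m) (cell x),
      (liftₗ f).map_smul (coeff x m), (liftₗ f).map_smul (coeff x m),
      smul_comm (MonoidAlgebra.single w (1 : k)) (coeff x m), single_smul_cell, liftₗ_cell, hf]
    split_ifs
    · rw [liftₗ_cell]
    · rw [map_zero]

open Classical in
theorem lift_cell (f : {x : 𝒜.Face // p x.supp} → M) (hf) (x : {x : 𝒜.Face // p x.supp}) :
    lift (k := k) f hf (cell x) = f x := by
  rw [lift, MonoidAlgebra.equivariantOfLinearOfComm_apply, liftₗ_cell]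

theorem hom_ext {f g : 𝒜.CellModule k p →ₗ[𝒜.FaceAlgebra k] M}
    (h : ∀ x, f (cell x) = g (cell x)) : f = g := by
  refine LinearMap.ext fun m => ?_
  exact LinearMap.congr_fun
    (linearMap_ext (f := f.restrictScalars k) (g := g.restrictScalars k) h) m

end CellModule

section Idempotents

variable {𝒜 k}

/-- The linear extension of the identity `xyx = xy` of a left regular band. -/
theorem single_mul_mul_single (w : 𝒜.Face) (a : 𝒜.FaceAlgebra k) :
    MonoidAlgebra.single w (1 : k) * a * MonoidAlgebra.single w 1 =
      MonoidAlgebra.single w 1 * a := by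
  induction a using MonoidAlgebra.induction_on with
  | of y =>
    rw [MonoidAlgebra.of_apply, MonoidAlgebra.single_mul_single, MonoidAlgebra.single_mul_single,
      mul_mul_self, mul_one, mul_one]
  | add a b ha hb => rw [mul_add, add_mul, ha, hb]
  | smul c a ha => rw [mul_smul_comm, smul_mul_assoc, ha]

/-- An element of the face algebra supported at and above the support of `l`, annihilated by the
faces whose support is not below that of `l`. -/
noncomputable def cutoff (k : Type u) [Field k] (l : 𝒜.Face) : 𝒜.FaceAlgebra k :=
  open Classical in
  MonoidAlgebra.single l 1 * ((Finset.univ.filter fun f : 𝒜.Face => ¬ f.supp ≤ l.supp).toList.map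
    fun f => (1 - MonoidAlgebra.single f 1 : 𝒜.FaceAlgebra k)).prod

/-- The factor `1 - w` occurs in the product, and `w a (1 - w) = 0` for every `a`, so its position
does not matter. -/
theorem single_mul_cutoff {w l : 𝒜.Face} (h : ¬ w.supp ≤ l.supp) :
    MonoidAlgebra.single w (1 : k) * cutoff k l = 0 := by
  classical
  have hw : w ∈ (Finset.univ.filter fun f : 𝒜.Face => ¬ f.supp ≤ l.supp).toList := by
    simpa using h
  obtain ⟨s, t, hst⟩ := List.append_of_mem hw
  rw [cutoff]
  simp only [hst, List.map_append, List.map_cons, List.prod_append, List.prod_cons]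
  have key : ∀ a : 𝒜.FaceAlgebra k,
      MonoidAlgebra.single w (1 : k) * a * (1 - MonoidAlgebra.single w 1) = 0 := fun a => by
    rw [mul_sub, mul_one, single_mul_mul_single, sub_self]
  rw [← mul_assoc, ← mul_assoc, ← mul_assoc, mul_assoc (MonoidAlgebra.single w 1), key, zero_mul]

open CellModule in
theorem cutoff_smul_cell {p : Submodule ℝ (Fin d → ℝ) → Prop} (l : {x : 𝒜.Face // p x.supp}) :
    cutoff k l.1 • (cell l : 𝒜.CellModule k p) = cell l := by
  classical
  have key : ∀ L : List 𝒜.Face, (∀ f ∈ L, ¬ f.supp ≤ l.1.supp) →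
      (L.map fun f => (1 - MonoidAlgebra.single f 1 : 𝒜.FaceAlgebra k)).prod •
        (cell l : 𝒜.CellModule k p) = cell l := by
    intro L hL
    induction L with
    | nil => simp
    | cons f L ih =>
      rw [List.map_cons, List.prod_cons, mul_smul, ih fun g hg => hL g (List.mem_cons_of_mem _ hg),
        sub_smul, one_smul, single_smul_cell, dif_neg (hL f List.mem_cons_self), sub_zero]
  rw [cutoff, mul_smul, key _ fun f hf => by simpa using hf, single_smul_cell, dif_pos le_rfl]
  congr 1
  exact Subtype.ext (mul_self l.1)

open CellModule in
-- Choose one face `r x` for each support. The map from the free module sending the basis vector `r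
-- x` to its cell is split by `x ↦ x * cutoff (r x)` placed at `r x`: the cutoff fixes the cell of
-- `r x`, and `x * r x = x`.
instance (p : Submodule ℝ (Fin d → ℝ) → Prop) :
    Module.Projective (𝒜.FaceAlgebra k) (𝒜.CellModule k p) := by
  classical
  let r : {x : 𝒜.Face // p x.supp} → {x : 𝒜.Face // p x.supp} := fun x =>
    Set.rangeSplitting (fun y : {x : 𝒜.Face // p x.supp} => y.1.supp) ⟨x.1.supp, x, rfl⟩
  have hr : ∀ x, (r x).1.supp = x.1.supp := fun x =>
    Set.apply_rangeSplitting (fun y : {x : 𝒜.Face // p x.supp} => y.1.supp) ⟨x.1.supp, x, rfl⟩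
  have hr' : ∀ x y, x.1.supp = y.1.supp → r x = r y := fun x y h => by
    simp only [r, h]
  let s : 𝒜.CellModule k p →ₗ[𝒜.FaceAlgebra k] ({x : 𝒜.Face // p x.supp} →₀ 𝒜.FaceAlgebra k) :=
    CellModule.lift (fun x => Finsupp.single (r x) (MonoidAlgebra.single x.1 1 * cutoff k (r x).1))
      fun w x => by
        rw [Finsupp.smul_single, smul_eq_mul, ← mul_assoc, MonoidAlgebra.single_mul_single, mul_one]
        split_ifs with h
        · rw [hr' (mulCell w x h) x (supp_mul_of_le h)]
          rfl
        · rw [single_mul_cutoff, Finsupp.single_zero]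
          rw [hr]
          exact fun h' => h ((left_supp_le_supp_mul _ _).trans h')
  refine Module.Projective.of_split s (Finsupp.linearCombination (𝒜.FaceAlgebra k) cell) ?_
  refine hom_ext fun x => ?_
  rw [LinearMap.comp_apply, CellModule.lift_cell, Finsupp.linearCombination_single, mul_smul,
    cutoff_smul_cell, single_smul_cell, dif_pos (hr x).ge, LinearMap.id_apply]
  congr 1
  exact Subtype.ext (mul_eq_left_iff.2 (hr x).le)

end Idempotents

end CentralArrangement

/-! ### The resolution of a one-dimensional module, and maps out of its terms -/

namespace CentralArrangement

open Face CellModule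

variable {d : ℕ} {𝒜 : CentralArrangement d} {k : Type u} [Field k]

namespace CellModule

variable {p q : Submodule ℝ (Fin d → ℝ) → Prop}

open Classical in
/-- Extension by zero of the coefficient function. -/
noncomputable def extend (m : 𝒜.CellModule k p) (x : 𝒜.Face) : k :=
  if h : p x.supp then coeff ⟨x, h⟩ m else 0

theorem extend_coe (m : 𝒜.CellModule k p) (x : {x : 𝒜.Face // p x.supp}) :
    extend m x.1 = coeff x m := dif_pos x.2

theorem extend_of_not (m : 𝒜.CellModule k p) {x : 𝒜.Face} (h : ¬ p x.supp) : extend m x = 0 :=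
  dif_neg h

theorem sum_cells (f : 𝒜.Face → k) (hf : ∀ x, ¬ p x.supp → f x = 0) :
    ∑ x : {x : 𝒜.Face // p x.supp}, f x.1 = ∑ x, f x := by
  classical
  rw [← Finset.sum_subset (Finset.subset_univ (Finset.univ.filter fun x : 𝒜.Face => p x.supp))]
  · exact (Finset.sum_subtype _ (fun x => by simp) f).symm
  · intro x _ hx
    exact hf x (by simpa using hx)

/-- The element with given coefficients. -/
noncomputable def ofFun (p : Submodule ℝ (Fin d → ℝ) → Prop) (f : 𝒜.Face → k) :
    𝒜.CellModule k p :=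
  ∑ x, f x.1 • cell x

theorem coeff_ofFun (f : 𝒜.Face → k) (x : {x : 𝒜.Face // p x.supp}) :
    coeff x (ofFun p f) = f x.1 := by
  classical
  rw [ofFun, map_sum]
  simp only [map_smul, coeff_cell, smul_eq_mul, mul_ite, mul_one, mul_zero]
  simp

/-- The coboundary as a module homomorphism. -/
noncomputable def boundary (p q : Submodule ℝ (Fin d → ℝ) → Prop) :
    𝒜.CellModule k p →ₗ[𝒜.FaceAlgebra k] 𝒜.CellModule k q :=
  CellModule.lift (fun x => ofFun q fun y => (incidence x.1 y : k)) fun w x => by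
    classical
    ext y
    rw [coeff_single_smul]
    have h1 := congrArg (Int.cast : ℤ → k) (sum_incidence_of_mul_eq w x.1 y.1)
    have h2 : ∑ v : {x : 𝒜.Face // q x.supp} with w.supp ≤ v.1.supp ∧ w * v.1 = y.1,
        coeff v (ofFun q fun y => (incidence x.1 y : k)) =
        ∑ v : 𝒜.Face with w.supp ≤ v.supp ∧ w * v = y.1, (incidence x.1 v : k) := by
      simp only [coeff_ofFun]
      rw [Finset.sum_filter, Finset.sum_filter]
      refine sum_cells (fun v : 𝒜.Face =>
        if w.supp ≤ v.supp ∧ w * v = y.1 then (incidence x.1 v : k) else 0) fun v hv => ?_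
      rw [if_neg]
      rintro ⟨h, h'⟩
      apply hv
      rw [← supp_mul_of_le h, h']
      exact y.2
    rw [h2]
    push_cast at h1
    rw [h1]
    split_ifs with h
    · rw [coeff_ofFun]
      rfl
    · rw [map_zero]

theorem coeff_boundary (m : 𝒜.CellModule k p) (y : {x : 𝒜.Face // q x.supp}) :
    coeff y (boundary p q m) = coboundary k (extend m) y.1 := by
  have h1 : coeff y (boundary p q m) =
      ∑ x : {x : 𝒜.Face // p x.supp}, (incidence x.1 y.1 : k) * extend m x.1 := by
    conv_lhs => rw [eq_sum m]
    rw [map_sum, map_sum]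
    refine Finset.sum_congr rfl fun x _ => ?_
    have : boundary p q (coeff x m • cell x : 𝒜.CellModule k p) =
        coeff x m • boundary p q (cell x) :=
      ((boundary p q).restrictScalars k).map_smul _ _
    rw [this, map_smul, boundary, CellModule.lift_cell, coeff_ofFun, smul_eq_mul, extend_coe,
      mul_comm]
  rw [h1, coboundary_apply]
  exact sum_cells (fun x : 𝒜.Face => (incidence x y.1 : k) * extend m x) fun x hx => by
    rw [extend_of_not m hx, mul_zero]

end CellModule

section Resolution

/-- The supports of codimension `i` in `X`. -/
def HasCodim (X : Submodule ℝ (Fin d → ℝ)) (i : ℕ) (Y : Submodule ℝ (Fin d → ℝ)) : Prop :=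
  Y ≤ X ∧ Module.finrank ℝ Y + i = Module.finrank ℝ X

variable {z : 𝒜.Face} {i : ℕ}

theorem hasCodim_zero_iff {X Y : Submodule ℝ (Fin d → ℝ)} : HasCodim X 0 Y ↔ Y = X :=
  ⟨fun h => Submodule.eq_of_le_of_finrank_le h.1 h.2.ge, fun h => h ▸ ⟨le_rfl, rfl⟩⟩

theorem HasCodim.of_coveredBy {X : Submodule ℝ (Fin d → ℝ)} {x y : 𝒜.Face}
    (hy : HasCodim X i y.supp) (h : x.CoveredBy y) : HasCodim X (i + 1) x.supp :=
  ⟨h.supp_lt.le.trans hy.1, by rw [← hy.2, h.2]; omega⟩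

theorem HasCodim.to_coveredBy {X : Submodule ℝ (Fin d → ℝ)} {x y : 𝒜.Face}
    (hx : HasCodim X (i + 1) x.supp) (hy : y.supp ≤ X) (h : x.CoveredBy y) :
    HasCodim X i y.supp :=
  ⟨hy, by rw [← hx.2, h.2]; omega⟩

theorem isTop_supp_le_iff {x : 𝒜.Face} : IsTop {x : 𝒜.Face | x.supp ≤ z.supp} x ↔
    x.supp = z.supp :=
  ⟨fun h => le_antisymm h.1 (h.2 z (le_refl z.supp)), fun h => ⟨h.le, fun _ hy => h ▸ hy⟩⟩

/-- Within `X`, every coface of a face of codimension `i + 1` has codimension `i`, so the full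
coboundary is already homogeneous. -/
theorem extend_boundary {X : Submodule ℝ (Fin d → ℝ)} (m : 𝒜.CellModule k (HasCodim X (i + 1)))
    {y : 𝒜.Face} (hy : y.supp ≤ X) :
    extend (boundary (HasCodim X (i + 1)) (HasCodim X i) m) y = coboundary k (extend m) y := by
  by_cases h : HasCodim X i y.supp
  · rw [extend_coe _ ⟨y, h⟩, coeff_boundary]
  · rw [extend_of_not _ h, coboundary_apply]
    refine (Finset.sum_eq_zero fun x _ => ?_).symm
    by_cases hx : HasCodim X (i + 1) x.supp
    · rw [incidence_of_not, Int.cast_zero, zero_mul]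
      exact fun hc => h (hx.to_coveredBy hy hc)
    · rw [extend_of_not _ hx, mul_zero]

theorem boundary_boundary (X : Submodule ℝ (Fin d → ℝ))
    (m : 𝒜.CellModule k (HasCodim X (i + 2))) :
    boundary (HasCodim X (i + 1)) (HasCodim X i) (boundary _ (HasCodim X (i + 1)) m) = 0 := by
  ext y
  rw [coeff_boundary, map_zero, ← Pi.zero_apply (M := fun _ : 𝒜.Face => k) y.1,
    ← coboundary_coboundary (extend m)]
  exact coboundary_congr fun x hx => extend_boundary m (hx.supp_lt.le.trans y.2.1)

theorem extend_eq_zero_of_not_le {X : Submodule ℝ (Fin d → ℝ)} (m : 𝒜.CellModule k (HasCodim X i))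
    (x : 𝒜.Face) (hx : x ∉ {x : 𝒜.Face | x.supp ≤ X}) : extend m x = 0 :=
  extend_of_not m fun h => hx h.1

theorem exists_boundary_eq (m : 𝒜.CellModule k (HasCodim z.supp i))
    (hm : ∀ y : 𝒜.Face, y.supp ≤ z.supp → coboundary k (extend m) y = 0)
    (ht : topSum k {x : 𝒜.Face | x.supp ≤ z.supp} (extend m) = 0) :
    ∃ w : 𝒜.CellModule k (HasCodim z.supp (i + 1)), boundary _ _ w = m := by
  obtain ⟨f, _, hf⟩ := (isConvex_supp_le z).acyclic (extend m) (extend_eq_zero_of_not_le m) hm ht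
  -- The primitive `f` need not be homogeneous; only its part of codimension `i + 1` affects the
  -- coboundary in codimension `i`.
  refine ⟨ofFun _ f, ?_⟩
  ext y
  rw [coeff_boundary, ← extend_coe, ← hf y.1 y.2.1]
  refine coboundary_congr fun x hx => ?_
  rw [extend_coe _ ⟨x, y.2.of_coveredBy hx⟩, coeff_ofFun]

theorem exists_boundary_eq_of_boundary_eq_zero
    (m : 𝒜.CellModule k (HasCodim z.supp (i + 1)))
    (hm : boundary (HasCodim z.supp (i + 1)) (HasCodim z.supp i) m = 0) :
    ∃ w : 𝒜.CellModule k (HasCodim z.supp (i + 2)), boundary _ _ w = m := by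
  refine exists_boundary_eq m (fun y hy => ?_) ?_
  · rw [← extend_boundary m hy, hm]
    by_cases h : HasCodim z.supp i y.supp
    · rw [extend_coe _ ⟨y, h⟩, map_zero]
    · exact extend_of_not _ h
  · classical
    rw [topSum_apply]
    refine Finset.sum_eq_zero fun x hx => extend_of_not _ fun h => ?_
    rw [isTop_supp_le_iff.1 (Finset.mem_filter.1 hx).2] at h
    have := h.2
    omega

variable {M : Type*} [AddCommGroup M] [Module k M] [Module (𝒜.FaceAlgebra k) M]
  [IsScalarTower k (𝒜.FaceAlgebra k) M]

/-- `v` is a vector on which every face acts by the character of `X`. -/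
def IsCharacterVector (k : Type u) [Field k] {M : Type*} [AddCommGroup M]
    [Module (𝒜.FaceAlgebra k) M] (X : Submodule ℝ (Fin d → ℝ)) (v : M) : Prop :=
  ∀ w : 𝒜.Face, (w.supp ≤ X → (MonoidAlgebra.single w (1 : k) : 𝒜.FaceAlgebra k) • v = v) ∧
    (¬ w.supp ≤ X → (MonoidAlgebra.single w (1 : k) : 𝒜.FaceAlgebra k) • v = 0)

/-- The augmentation of the resolution. -/
noncomputable def augmentation {X : Submodule ℝ (Fin d → ℝ)} {v : M}
    (hv : IsCharacterVector (𝒜 := 𝒜) k X v) :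
    𝒜.CellModule k (HasCodim X 0) →ₗ[𝒜.FaceAlgebra k] M :=
  CellModule.lift (fun _ => v) fun w x => by
    have hx : x.1.supp = X := hasCodim_zero_iff.1 x.2
    split_ifs with h
    · exact (hv w).1 (h.trans hx.le)
    · exact (hv w).2 fun h' => h (h'.trans hx.ge)

theorem augmentation_apply {v : M} (hv : IsCharacterVector (𝒜 := 𝒜) k z.supp v)
    (m : 𝒜.CellModule k (HasCodim z.supp 0)) :
    augmentation hv m = topSum k {x : 𝒜.Face | x.supp ≤ z.supp} (extend m) • v := by
  classical
  conv_lhs => rw [eq_sum m]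
  rw [map_sum, topSum_apply, Finset.sum_smul, Finset.sum_filter]
  have h1 : ∀ x ∈ (Finset.univ : Finset {x : 𝒜.Face // HasCodim z.supp 0 x.supp}),
      augmentation hv (coeff x m • cell x) = extend m x.1 • v := fun x _ => by
    have : augmentation hv (coeff x m • cell x) = coeff x m • augmentation hv (cell x) :=
      ((augmentation hv).restrictScalars k).map_smul _ _
    rw [this, augmentation, CellModule.lift_cell, extend_coe]
  rw [Finset.sum_congr rfl h1, ← Finset.sum_smul, sum_cells _ fun x => extend_of_not m,
    Finset.sum_smul]
  refine Finset.sum_congr rfl fun x _ => ?_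
  rw [isTop_supp_le_iff]
  split_ifs with h
  · rfl
  · rw [extend_of_not m (hasCodim_zero_iff.not.2 h), zero_smul]

theorem augmentation_boundary {v : M} (hv : IsCharacterVector (𝒜 := 𝒜) k z.supp v)
    (m : 𝒜.CellModule k (HasCodim z.supp 1)) : augmentation hv (boundary _ _ m) = 0 := by
  rw [augmentation_apply]
  have : topSum k {x : 𝒜.Face | x.supp ≤ z.supp}
      (extend (boundary (HasCodim z.supp (0 + 1)) (HasCodim z.supp 0) m)) =
      topSum k {x : 𝒜.Face | x.supp ≤ z.supp} (coboundary k (extend m)) :=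
    topSum_congr fun x hx => extend_boundary m hx.1
  rw [this, (isConvex_supp_le z).topSum_coboundary_eq_zero (extend_eq_zero_of_not_le m),
    zero_smul]

theorem exists_boundary_eq_of_augmentation_eq_zero {v : M}
    (hv : IsCharacterVector (𝒜 := 𝒜) k z.supp v) (hv0 : v ≠ 0)
    (m : 𝒜.CellModule k (HasCodim z.supp 0)) (hm : augmentation hv m = 0) :
    ∃ w : 𝒜.CellModule k (HasCodim z.supp 1), boundary _ _ w = m := by
  rw [augmentation_apply, smul_eq_zero, or_iff_left hv0] at hm
  refine exists_boundary_eq m (fun y hy => ?_) hm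
  rw [coboundary_apply]
  refine Finset.sum_eq_zero fun x _ => ?_
  by_cases hx : HasCodim z.supp 0 x.supp
  · rw [incidence_of_not, Int.cast_zero, zero_mul]
    exact fun h => absurd (hasCodim_zero_iff.1 hx ▸ h.supp_lt) (not_lt_of_ge hy)
  · rw [extend_of_not _ hx, mul_zero]

theorem augmentation_surjective {v : M} (hv : IsCharacterVector (𝒜 := 𝒜) k z.supp v)
    (hM : ∀ m : M, ∃ c : k, m = c • v) : Function.Surjective (augmentation hv) := by
  intro m
  obtain ⟨c, rfl⟩ := hM m
  refine ⟨c • cell ⟨z, hasCodim_zero_iff.2 rfl⟩, ?_⟩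
  have : augmentation hv (c • cell ⟨z, hasCodim_zero_iff.2 rfl⟩) =
      c • augmentation hv (cell ⟨z, hasCodim_zero_iff.2 rfl⟩) :=
    ((augmentation hv).restrictScalars k).map_smul _ _
  rw [this, augmentation, CellModule.lift_cell]

/-- The face `x` fixes its own cell, so a nonzero image needs `x.supp ≤ Y`. A face `w` of support
`Y` fixes the image but kills the cell unless `Y ≤ x.supp`. Hence only cells of support `Y` survive.
-/
theorem hom_eq_zero {X Y : Submodule ℝ (Fin d → ℝ)} (hY : ∃ w : 𝒜.Face, w.supp = Y) {v : M}
    (hv : IsCharacterVector (𝒜 := 𝒜) k Y v) (hM : ∀ m : M, ∃ c : k, m = c • v)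
    (h : ¬ HasCodim X i Y)
    (f : 𝒜.CellModule k (HasCodim X i) →ₗ[𝒜.FaceAlgebra k] M) : f = 0 := by
  classical
  refine hom_ext fun x => ?_
  rw [LinearMap.zero_apply]
  obtain ⟨w, rfl⟩ := hY
  obtain ⟨c, hc⟩ := hM (f (cell x))
  have hact : ∀ y : 𝒜.Face, (MonoidAlgebra.single y (1 : k) : 𝒜.FaceAlgebra k) • f (cell x) =
      c • (MonoidAlgebra.single y (1 : k) : 𝒜.FaceAlgebra k) • v := fun y => by
    rw [hc, smul_comm]
  have hx : (MonoidAlgebra.single x.1 (1 : k) : 𝒜.FaceAlgebra k) • f (cell x) = f (cell x) := by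
    rw [← map_smul, single_smul_cell, dif_pos le_rfl]
    exact congrArg (fun y => f (cell y)) (Subtype.ext (mul_self x.1))
  by_cases hle : x.1.supp ≤ w.supp
  · have hw : ¬ w.supp ≤ x.1.supp := fun h' => h (le_antisymm hle h' ▸ x.2)
    have := hact w
    rwa [(hv w).1 le_rfl, ← hc, ← map_smul, single_smul_cell, dif_neg hw, map_zero, eq_comm] at this
  · rw [← hx, hact, (hv _).2 hle, smul_zero]

/-- The generator sends each cell of support `Y` to `v` and all others to `0`. Any map takes one
value on the cells of support `Y`, since `x` carries the cell of `w` to that of `x` when their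
supports agree. -/
theorem exists_hom_generator {X Y : Submodule ℝ (Fin d → ℝ)} (hY : ∃ w : 𝒜.Face, w.supp = Y) {v : M}
    (hv : IsCharacterVector (𝒜 := 𝒜) k Y v) (hv0 : v ≠ 0) (hM : ∀ m : M, ∃ c : k, m = c • v)
    (h : HasCodim X i Y) :
    ∃ g : 𝒜.CellModule k (HasCodim X i) →ₗ[𝒜.FaceAlgebra k] M, g ≠ 0 ∧
      ∀ f : 𝒜.CellModule k (HasCodim X i) →ₗ[𝒜.FaceAlgebra k] M, ∃ c : k,
        ∀ m, f m = c • g m := by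
  classical
  obtain ⟨w, rfl⟩ := hY
  let g : 𝒜.CellModule k (HasCodim X i) →ₗ[𝒜.FaceAlgebra k] M :=
    CellModule.lift (fun x => if x.1.supp = w.supp then v else 0) fun y x => by
      by_cases hy : y.supp ≤ x.1.supp
      · rw [dif_pos hy, mulCell, supp_mul_of_le hy]
        split_ifs with hx
        · exact (hv y).1 (hy.trans hx.le)
        · rw [smul_zero]
      · rw [dif_neg hy]
        split_ifs with hx
        · exact (hv y).2 fun h' => hy (h'.trans hx.ge)
        · rw [smul_zero]
  have hg : ∀ x, g (cell x) = if x.1.supp = w.supp then v else 0 := fun x =>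
    CellModule.lift_cell _ _ _
  refine ⟨g, fun h0 => hv0 ?_, fun f => ?_⟩
  · have := hg ⟨w, h⟩
    rw [h0, if_pos rfl] at this
    exact this.symm
  · obtain ⟨c, hc⟩ := hM (f (cell ⟨w, h⟩))
    refine ⟨c, fun m => ?_⟩
    have key : f.restrictScalars k = c • g.restrictScalars k := by
      refine linearMap_ext fun x => ?_
      change f (cell x) = c • g (cell x)
      rw [hg]
      have hx : (MonoidAlgebra.single x.1 (1 : k) : 𝒜.FaceAlgebra k) • f (cell x) =
          f (cell x) := by
        rw [← map_smul, single_smul_cell, dif_pos le_rfl]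
        exact congrArg (fun y => f (cell y)) (Subtype.ext (mul_self x.1))
      by_cases hs : x.1.supp = w.supp
      · rw [if_pos hs, ← hc]
        have e : (MonoidAlgebra.single x.1 (1 : k) : 𝒜.FaceAlgebra k) • f (cell ⟨w, h⟩) =
            f (cell x) := by
          rw [← map_smul, single_smul_cell, dif_pos hs.le]
          exact congrArg (fun y => f (cell y)) (Subtype.ext (mul_eq_left_iff.2 hs.ge))
        rw [← e, hc, smul_comm, (hv _).1 hs.le]
      · rw [if_neg hs, smul_zero]
        obtain ⟨b, hb⟩ := hM (f (cell x))
        by_cases hle : x.1.supp ≤ w.supp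
        · have hw : ¬ w.supp ≤ x.1.supp := fun h' => hs (le_antisymm hle h')
          have : (MonoidAlgebra.single w (1 : k) : 𝒜.FaceAlgebra k) • f (cell x) = f (cell x) := by
            rw [hb, smul_comm, (hv _).1 le_rfl]
          rw [← this, ← map_smul, single_smul_cell, dif_neg hw, map_zero]
        · rw [← hx, hb, smul_comm, (hv _).2 hle, smul_zero]
    exact LinearMap.congr_fun key m

end Resolution

end CentralArrangement

/-! ### Ext from a resolution with vanishing consecutive Homs -/

namespace CategoryTheory.Abelian

open Limits Ext

universe w' v' u'

variable {C : Type u'} [Category.{v'} C] [Abelian C] {k : Type*} [CommRing k]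
  [Linear k C]

/-- Under either alternative every map `P₀ ⟶ N` vanishes on the image of `d`, hence descends to `M`.
-/
theorem nonempty_hom_equiv_of_exact {P₁ P₀ M N : C} {d : P₁ ⟶ P₀} {ε : P₀ ⟶ M}
    {w : d ≫ ε = 0} [Epi ε] (h : (ShortComplex.mk d ε w).Exact)
    (hN : Subsingleton (P₀ ⟶ N) ∨ Subsingleton (P₁ ⟶ N)) :
    Nonempty ((M ⟶ N) ≃ₗ[k] (P₀ ⟶ N)) := by
  refine ⟨LinearEquiv.ofBijective (Linear.leftComp k N ε) ⟨fun f g hfg => ?_, fun f => ?_⟩⟩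
  · exact (cancel_epi ε).1 hfg
  · have hf : d ≫ f = 0 := by
      rcases hN with hN | hN
      · rw [Subsingleton.elim f 0, Limits.comp_zero]
      · exact Subsingleton.elim _ _
    have : Epi (ShortComplex.mk d ε w).g := ‹Epi ε›
    exact ⟨h.desc f hf, h.g_desc f hf⟩

variable [HasExt.{w'} C]

/-- Dimension shifting along the kernel of an epimorphism from a projective object. -/
theorem nonempty_ext_kernel_equiv {P₀ M N : C} [Projective P₀] (ε : P₀ ⟶ M) [Epi ε] (p : ℕ)
    (h : p = 0 → ∀ f : P₀ ⟶ N, kernel.ι ε ≫ f = 0) :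
    Nonempty (Ext (kernel ε) N p ≃ₗ[k] Ext M N (p + 1)) := by
  let S : ShortComplex C := ShortComplex.mk (kernel.ι ε) ε (kernel.condition ε)
  have hS : S.ShortExact := { exact := ShortComplex.exact_kernel ε }
  let δ : Ext (kernel ε) N p →ₗ[k] Ext M N (p + 1) :=
    precompOfLinear hS.extClass k N (Nat.add_comm 1 p)
  refine ⟨LinearEquiv.ofBijective δ ⟨?_, fun x => ?_⟩⟩
  · rw [injective_iff_map_eq_zero]
    intro x hx
    obtain ⟨y, rfl⟩ := contravariant_sequence_exact₁ hS N x (Nat.add_comm 1 p) hx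
    -- In degree 0 the connecting map kills exactly the maps that extend to `P₀`, which `h` makes
    -- zero; in positive degree `Ext` from `P₀` vanishes.
    rcases p with _ | p
    · obtain ⟨f, rfl⟩ := (Ext.addEquiv₀ (X := P₀) (Y := N)).symm.surjective y
      change (mk₀ (kernel.ι ε)).comp (mk₀ f) _ = 0
      rw [mk₀_comp_mk₀, h rfl, mk₀_zero]
    · rw [eq_zero_of_projective (P := P₀) y, Ext.comp_zero]
  · exact contravariant_sequence_exact₃ hS N x (eq_zero_of_projective (P := P₀) _)
      (Nat.add_comm 1 p)

/-- `Ext` computed by a projective resolution `P` of `M` such that of any two consecutive terms one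
has no nonzero morphism to `N`. -/
theorem nonempty_ext_equiv_of_resolution (p : ℕ) : ∀ {M N : C} (P : ℕ → C)
    [∀ i, Projective (P i)] (d : ∀ i, P (i + 1) ⟶ P i) (ε : P 0 ⟶ M) [Epi ε]
    (w₀ : d 0 ≫ ε = 0) (w : ∀ i, d (i + 1) ≫ d i = 0)
    (_ : (ShortComplex.mk _ _ w₀).Exact) (_ : ∀ i, (ShortComplex.mk _ _ (w i)).Exact)
    (_ : ∀ i, Subsingleton (P i ⟶ N) ∨ Subsingleton (P (i + 1) ⟶ N)),
    Nonempty (Ext M N p ≃ₗ[k] (P p ⟶ N)) := by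
  induction p with
  | zero =>
    intro M N P _ d ε _ w₀ w h₀ h hN
    obtain ⟨e⟩ := nonempty_hom_equiv_of_exact (k := k) h₀ (hN 0)
    exact ⟨Ext.linearEquiv₀.trans e⟩
  | succ p ih =>
    intro M N P _ d ε _ w₀ w h₀ h hN
    -- The resolution with its first term removed resolves `kernel ε`, and the induction hypothesis
    -- applies to it.
    let ε' : P 1 ⟶ kernel ε := kernel.lift ε (d 0) w₀
    have : Epi ε' := h₀.epi_kernelLift
    have hε' : ε' ≫ kernel.ι ε = d 0 := kernel.lift_ι _ _ _
    have w₀' : d 1 ≫ ε' = 0 := by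
      rw [← cancel_mono (kernel.ι ε), Category.assoc, hε', w 0, Limits.zero_comp]
    have h₀' : (ShortComplex.mk _ _ w₀').Exact := by
      let φ : ShortComplex.mk _ _ w₀' ⟶ ShortComplex.mk _ _ (w 0) :=
        { τ₁ := 𝟙 _, τ₂ := 𝟙 _, τ₃ := kernel.ι ε }
      have : Epi φ.τ₁ := inferInstanceAs (Epi (𝟙 _))
      have : IsIso φ.τ₂ := inferInstanceAs (IsIso (𝟙 _))
      have : Mono φ.τ₃ := inferInstanceAs (Mono (kernel.ι ε))
      exact (ShortComplex.exact_iff_of_epi_of_isIso_of_mono φ).2 (h 0)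
    obtain ⟨e⟩ := ih (fun i => P (i + 1)) (fun i => d (i + 1)) ε' w₀' (fun i => w (i + 1)) h₀'
      (fun i => h (i + 1)) (fun i => hN (i + 1))
    obtain ⟨e'⟩ := nonempty_ext_kernel_equiv (k := k) (N := N) ε p fun _ f => by
      rw [← cancel_epi ε', ← Category.assoc, hε', Limits.comp_zero]
      rcases hN 0 with hN | hN
      · rw [Subsingleton.elim f 0, Limits.comp_zero]
      · exact Subsingleton.elim _ _
    exact ⟨e'.symm.trans e⟩

end CategoryTheory.Abelian

/-! ### Simple modules and the extensions between them -/

namespace CentralArrangement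

open Face CellModule

open scoped ModuleCat

variable {d : ℕ} {𝒜 : CentralArrangement d} {k : Type u} [Field k]

/-- `M` is one dimensional and the faces act by the character of `X`. -/
def HasCharacter (𝒜 : CentralArrangement d) (k : Type u) [Field k] (M : Type*) [AddCommGroup M]
    [Module k M] [Module (𝒜.FaceAlgebra k) M] (X : Submodule ℝ (Fin d → ℝ)) : Prop :=
  ∃ v : M, v ≠ 0 ∧ IsCharacterVector (𝒜 := 𝒜) k X v ∧ ∀ m : M, ∃ c : k, m = c • v

section Characters

variable {M N : Type*} [AddCommGroup M] [Module k M] [Module (𝒜.FaceAlgebra k) M]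
  [IsScalarTower k (𝒜.FaceAlgebra k) M] [AddCommGroup N] [Module k N]
  [Module (𝒜.FaceAlgebra k) N] [IsScalarTower k (𝒜.FaceAlgebra k) N]

theorem HasCharacter.of_equiv {X : Submodule ℝ (Fin d → ℝ)} (h : HasCharacter 𝒜 k M X)
    (e : M ≃ₗ[𝒜.FaceAlgebra k] N) : HasCharacter 𝒜 k N X := by
  obtain ⟨v, hv0, hv, hM⟩ := h
  refine ⟨e v, fun h0 => hv0 (e.map_eq_zero_iff.1 h0), fun w => ⟨fun hw => ?_, fun hw => ?_⟩,
    fun n => ?_⟩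
  · rw [← map_smul, (hv w).1 hw]
  · rw [← map_smul, (hv w).2 hw, map_zero]
  · obtain ⟨c, hc⟩ := hM (e.symm n)
    refine ⟨c, ?_⟩
    rw [← e.apply_symm_apply n, hc]
    exact (e.restrictScalars k).map_smul c v

theorem HasCharacter.nonempty_equiv {X : Submodule ℝ (Fin d → ℝ)} (h : HasCharacter 𝒜 k M X)
    (h' : HasCharacter 𝒜 k N X) : Nonempty (M ≃ₗ[𝒜.FaceAlgebra k] N) := by
  obtain ⟨v, hv0, hv, hM⟩ := h
  obtain ⟨u, hu0, hu, hN⟩ := h'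
  let eM : k ≃ₗ[k] M := LinearEquiv.ofBijective (LinearMap.toSpanSingleton k M v)
    ⟨fun a b hab => smul_left_injective k hv0 hab, fun m => by
      obtain ⟨c, rfl⟩ := hM m
      exact ⟨c, rfl⟩⟩
  let eN : k ≃ₗ[k] N := LinearEquiv.ofBijective (LinearMap.toSpanSingleton k N u)
    ⟨fun a b hab => smul_left_injective k hu0 hab, fun m => by
      obtain ⟨c, rfl⟩ := hN m
      exact ⟨c, rfl⟩⟩
  let f : M ≃ₗ[k] N := eM.symm.trans eN
  have hf : f v = u := by
    have h1 : eM 1 = v := one_smul k v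
    have h2 : eN 1 = u := one_smul k u
    change eN (eM.symm v) = u
    rw [← h1, LinearEquiv.symm_apply_apply, h2]
  have hcomm : ∀ (w : 𝒜.Face) (m : M), f.toLinearMap
      ((MonoidAlgebra.single w (1 : k) : 𝒜.FaceAlgebra k) • m) =
      (MonoidAlgebra.single w (1 : k) : 𝒜.FaceAlgebra k) • f.toLinearMap m := by
    intro w m
    obtain ⟨c, rfl⟩ := hM m
    rw [smul_comm, LinearMap.map_smul, LinearMap.map_smul, smul_comm _ c]
    congr 1
    change f _ = _ • f v
    rw [hf]
    by_cases hw : w.supp ≤ X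
    · rw [(hv w).1 hw, (hu w).1 hw, hf]
    · rw [(hv w).2 hw, (hu w).2 hw, map_zero]
  exact ⟨LinearEquiv.ofBijective (MonoidAlgebra.equivariantOfLinearOfComm f.toLinearMap hcomm)
    f.bijective⟩

theorem HasCharacter.supp_le {X : Submodule ℝ (Fin d → ℝ)} {w : 𝒜.Face}
    (h : HasCharacter 𝒜 k M w.supp) (h' : HasCharacter 𝒜 k M X) : w.supp ≤ X := by
  obtain ⟨v, hv0, hv, hM⟩ := h
  obtain ⟨u, hu0, hu, -⟩ := h'
  by_contra hw
  obtain ⟨c, rfl⟩ := hM u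
  have := (hu w).2 hw
  rw [smul_comm, (hv w).1 le_rfl] at this
  exact hu0 this

variable (𝒜 k M) in
/-- The simple modules are the one dimensional modules given by the characters. -/
theorem exists_hasCharacter [IsSimpleModule (𝒜.FaceAlgebra k) M] :
    ∃ x : 𝒜.Face, HasCharacter 𝒜 k M x.supp := by
  have : Nontrivial M := IsSimpleModule.nontrivial (𝒜.FaceAlgebra k) M
  let a : 𝒜.Face → 𝒜.FaceAlgebra k := fun x => MonoidAlgebra.single x 1
  have ha : ∀ (x y : 𝒜.Face) (m : M), a x • a y • m = a (x * y) • m := fun x y m => by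
    rw [smul_smul, MonoidAlgebra.single_mul_single, mul_one]
  -- The face `x` has largest support dimension among those acting nontrivially, so any face of
  -- strictly larger support acts by zero.
  obtain ⟨x, ⟨m₀, hm₀⟩, hmax⟩ := (Set.toFinite {x : 𝒜.Face | ∃ m : M, a x • m ≠ 0}).exists_maximalFor
    (fun x : 𝒜.Face => Module.finrank ℝ x.supp) _ (by
      obtain ⟨m, hm⟩ := exists_ne (0 : M)
      exact ⟨1, m, by rwa [show a 1 = 1 from rfl, one_smul]⟩)
  have hkill : ∀ (y : 𝒜.Face) (m : M), x.supp < y.supp → a y • m = 0 := by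
    intro y m hy
    by_contra hne
    have h1 := Submodule.finrank_lt_finrank_of_lt hy
    exact absurd (hmax ⟨m, hne⟩ h1.le) (not_le_of_gt h1)
  have lt_mul : ∀ {y : 𝒜.Face}, ¬ y.supp ≤ x.supp →
      x.supp < (x * y).supp ∧ x.supp < (y * x).supp := fun {y} hy =>
    ⟨lt_of_le_of_ne (left_supp_le_supp_mul _ _) fun h => hy (h ▸ right_supp_le_supp_mul _ _),
      lt_of_le_of_ne (right_supp_le_supp_mul _ _) fun h => hy (h ▸ left_supp_le_supp_mul _ _)⟩
  -- If `u` were nonzero it would generate `M`. But `x` kills `u`, and `x * y` is either `x` or of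
  -- larger support, so `x` would kill all of `M`.
  have hconst : ∀ y : 𝒜.Face, y.supp = x.supp → a y • m₀ = a x • m₀ := by
    intro y hy
    by_contra hne
    set u : M := a x • m₀ - a y • m₀ with hu
    have hu0 : u ≠ 0 := fun h => hne (sub_eq_zero.1 h).symm
    have hxu : a x • u = 0 := by
      rw [hu, smul_sub, ha, ha, mul_self, mul_eq_left_iff.2 hy.le, sub_self]
    obtain ⟨b, hb⟩ := IsSimpleModule.toSpanSingleton_surjective (𝒜.FaceAlgebra k) hu0 m₀
    rw [LinearMap.toSpanSingleton_apply] at hb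
    have hxb : ∀ b : 𝒜.FaceAlgebra k, a x • b • u = 0 := by
      intro b
      induction b using MonoidAlgebra.induction_on with
      | of y =>
        change a x • a y • u = 0
        rw [ha]
        by_cases hyx : y.supp ≤ x.supp
        · rw [mul_eq_left_iff.2 hyx, hxu]
        · exact hkill _ _ (lt_mul hyx).1
      | add b c hb hc => rw [add_smul, smul_add, hb, hc, add_zero]
      | smul c b hb => rw [smul_assoc, smul_comm, hb, smul_zero]
    exact hm₀ (by rw [← hb, hxb])
  have hchar : IsCharacterVector (𝒜 := 𝒜) k x.supp (a x • m₀) := by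
    refine fun w => ⟨fun hw => ?_, fun hw => ?_⟩
    · change a w • a x • m₀ = _
      rw [ha, hconst _ (supp_mul_of_le hw)]
    · change a w • a x • m₀ = _
      rw [ha, hkill _ _ (lt_mul hw).2]
  refine ⟨x, a x • m₀, hm₀, hchar, fun m => ?_⟩
  obtain ⟨b, rfl⟩ := IsSimpleModule.toSpanSingleton_surjective (𝒜.FaceAlgebra k) hm₀ m
  rw [LinearMap.toSpanSingleton_apply]
  induction b using MonoidAlgebra.induction_on with
  | of w =>
    by_cases hw : w.supp ≤ x.supp
    · exact ⟨1, by rw [one_smul]; exact (hchar w).1 hw⟩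
    · exact ⟨0, by rw [zero_smul]; exact (hchar w).2 hw⟩
  | add b c hb hc =>
    obtain ⟨r, hr⟩ := hb
    obtain ⟨s, hs⟩ := hc
    exact ⟨r + s, by rw [add_smul, add_smul, hr, hs]⟩
  | smul c b hb =>
    obtain ⟨r, hr⟩ := hb
    exact ⟨c * r, by rw [smul_assoc, hr, mul_smul]⟩

end Characters

theorem isSplitBasic_faceAlgebra : IsSplitBasic k (𝒜.FaceAlgebra k) := by
  refine ⟨inferInstance, fun M _ _ _ _ _ => ?_⟩
  obtain ⟨_, v, hv0, -, hM⟩ := exists_hasCharacter 𝒜 k M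
  exact finrank_eq_one v hv0 fun m => (hM m).imp fun c hc => hc.symm

theorem hasCharacter_simpleModule (X : 𝒜.IntersectionLattice) :
    HasCharacter 𝒜 k (simpleModule k X) X.1 := by
  have hs : ∀ (b : 𝒜.FaceAlgebra k) (m : k),
      b • (show simpleModule k X from m) = (show simpleModule k X from character k X b * m) :=
    fun _ _ => rfl
  have hw : ∀ w : 𝒜.Face, character k X (MonoidAlgebra.single w 1) = characterOnFaces k X w :=
    fun w => by rw [character, MonoidAlgebra.lift_single, one_smul]
  refine ⟨show simpleModule k X from (1 : k), one_ne_zero (α := k),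
    fun w => ⟨fun h => ?_, fun h => ?_⟩, fun m => ⟨(m : k), ?_⟩⟩
  · rw [hs, hw, show characterOnFaces k X w = 1 from if_pos h, one_mul]
  · rw [hs, hw, show characterOnFaces k X w = 0 from if_neg h, zero_mul]
    rfl
  · change m = algebraMap k (𝒜.FaceAlgebra k) m • (show simpleModule k X from (1 : k))
    have : ∀ c : k, character k X (algebraMap k (𝒜.FaceAlgebra k) c) * 1 = c := fun c => by
      rw [AlgHom.commutes, mul_one]
      rfl
    exact (this m).symm

section Ext

open Abelian

variable {M N : ModuleCat.{u} (𝒜.FaceAlgebra k)}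

/-- The extensions between one dimensional modules. -/
theorem nonempty_ext_equiv_hom {z w : 𝒜.Face} (hM : HasCharacter 𝒜 k M z.supp)
    (hN : HasCharacter 𝒜 k N w.supp) (p : ℕ) :
    Nonempty (Ext M N p ≃ₗ[k]
      (ModuleCat.of (𝒜.FaceAlgebra k) (𝒜.CellModule k (HasCodim z.supp p)) ⟶ N)) := by
  obtain ⟨v, hv0, hv, hMv⟩ := hM
  obtain ⟨u, hu0, hu, hNu⟩ := hN
  let P : ℕ → ModuleCat.{u} (𝒜.FaceAlgebra k) := fun i =>
    ModuleCat.of _ (𝒜.CellModule k (HasCodim z.supp i))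
  have hP : ∀ i, Projective (P i) := fun i => ModuleCat.projective_of_categoryTheory_projective _
  let D : ∀ i, P (i + 1) ⟶ P i := fun i =>
    ModuleCat.ofHom (boundary (HasCodim z.supp (i + 1)) (HasCodim z.supp i))
  let ε : P 0 ⟶ M := ModuleCat.ofHom (augmentation hv)
  have : Epi ε := (ModuleCat.epi_iff_surjective _).2 (augmentation_surjective hv hMv)
  refine nonempty_ext_equiv_of_resolution (k := k) p P D ε ?_ ?_ ?_ ?_ ?_
  · ext m
    exact augmentation_boundary hv m
  · exact fun i => ModuleCat.hom_ext (LinearMap.ext fun m => boundary_boundary z.supp m)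
  · rw [ShortComplex.moduleCat_exact_iff]
    exact fun m hm => exists_boundary_eq_of_augmentation_eq_zero hv hv0 m hm
  · intro i
    rw [ShortComplex.moduleCat_exact_iff]
    exact fun m hm => exists_boundary_eq_of_boundary_eq_zero m hm
  · intro i
    -- A subspace has only one codimension in `z.supp`, so of two consecutive terms at least one has
    -- no nonzero map to `N`.
    have key : ∀ j, ¬ HasCodim z.supp j w.supp → Subsingleton (P j ⟶ N) := fun j hj =>
      subsingleton_of_forall_eq 0 fun f =>
        ModuleCat.hom_ext (hom_eq_zero ⟨w, rfl⟩ hu hNu hj f.hom)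
    by_cases h : HasCodim z.supp i w.supp
    · refine Or.inr (key _ fun h' => ?_)
      have h1 := h.2
      have h2 := h'.2
      omega
    · exact Or.inl (key _ h)

theorem nonempty_ext_equiv {z w : 𝒜.Face} (hM : HasCharacter 𝒜 k M z.supp)
    (hN : HasCharacter 𝒜 k N w.supp) {p : ℕ} (h : HasCodim z.supp p w.supp) :
    Nonempty (Ext M N p ≃ₗ[k] k) := by
  obtain ⟨e⟩ := nonempty_ext_equiv_hom hM hN p
  obtain ⟨u, hu0, hu, hNu⟩ := hN
  obtain ⟨g, hg0, hg⟩ := exists_hom_generator ⟨w, rfl⟩ hu hu0 hNu h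
  have hg0' : ModuleCat.ofHom g ≠ 0 := fun h0 => hg0 (congrArg ModuleCat.Hom.hom h0)
  refine ⟨e.trans (LinearEquiv.ofBijective (LinearMap.toSpanSingleton k _ (ModuleCat.ofHom g))
    ⟨fun a b hab => smul_left_injective k hg0' hab, fun f => ?_⟩).symm⟩
  obtain ⟨c, hc⟩ := hg f.hom
  refine ⟨c, ?_⟩
  ext m
  exact (hc m).symm

theorem subsingleton_ext {z w : 𝒜.Face} (hM : HasCharacter 𝒜 k M z.supp)
    (hN : HasCharacter 𝒜 k N w.supp) {p : ℕ} (h : ¬ HasCodim z.supp p w.supp) :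
    Subsingleton (Ext M N p) := by
  obtain ⟨e⟩ := nonempty_ext_equiv_hom hM hN p
  obtain ⟨u, hu0, hu, hNu⟩ := hN
  exact subsingleton_of_forall_eq 0 fun x => e.injective
    (ModuleCat.hom_ext ((hom_eq_zero ⟨w, rfl⟩ hu hNu h (e x).hom).trans
      (hom_eq_zero ⟨w, rfl⟩ hu hNu h (e 0).hom).symm))

end Ext

/-- If `Y < X`, some hyperplane `H` contains `Y` but not `X`. The trace of `H` on `X` is the support
of a top face of the slice, has codimension one and contains `Y`; a cover forces equality. -/
theorem hasCodim_one_iff_covBy {X Y : 𝒜.IntersectionLattice} : HasCodim X.1 1 Y.1 ↔ Y ⋖ X := by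
  constructor
  · intro h
    have hlt : Y < X := by
      refine lt_of_le_of_ne h.1 fun he => ?_
      have := h.2
      rw [he] at this
      omega
    refine ⟨hlt, fun Z hYZ hZX => ?_⟩
    have h1 := Submodule.finrank_lt_finrank_of_lt (show Y.1 < Z.1 from hYZ)
    have h2 := Submodule.finrank_lt_finrank_of_lt (show Z.1 < X.1 from hZX)
    have := h.2
    omega
  · obtain ⟨_, x, rfl⟩ := X
    obtain ⟨_, y, rfl⟩ := Y
    intro h
    have hlt : y.supp < x.supp := h.1
    obtain ⟨H, hy, hx⟩ := exists_sign_of_supp_lt hlt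
    have hU := isConvex_supp_le x
    have hxt : IsTop {f : 𝒜.Face | f.supp ≤ x.supp} x := isTop_supp_le_iff.2 rfl
    have hys : y ∈ slice {f : 𝒜.Face | f.supp ≤ x.supp} H 0 := ⟨hlt.le, hy⟩
    obtain ⟨t, ht⟩ := (hU.slice H 0).exists_isTop ⟨y, hys⟩
    have hd := IsTop.finrank_slice_zero hU ht hxt hx
    have htx : t.supp < x.supp := by
      refine lt_of_le_of_ne ht.1.1 fun he => ?_
      rw [he] at hd
      omega
    have hyt : y.supp = t.supp := by
      by_contra hne
      exact h.2 (c := ⟨t.supp, t, rfl⟩) (lt_of_le_of_ne (ht.2 y hys)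
        fun he => hne (congrArg Subtype.val he)) htx
    exact ⟨hlt.le, by change Module.finrank ℝ y.supp + 1 = _; rw [hyt, hd]⟩

/-! ### The Ext-quiver -/

section Quiver

theorem nonempty_rep_iso (M : ModuleCat.{u} (𝒜.FaceAlgebra k))
    [h : IsSimpleModule (𝒜.FaceAlgebra k) M] :
    Nonempty (M ≅ ExtQuiver.rep (k := k) (ExtQuiver.mk M)) := by
  obtain ⟨e⟩ : Nonempty (_ ≅ _) := Quotient.exact (Quotient.out_eq
    (Quotient.mk (simpleModuleSetoid (𝒜.FaceAlgebra k)) ⟨M, h⟩))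
  exact ⟨e.symm⟩

theorem hasCharacter_rep (X : 𝒜.IntersectionLattice) :
    HasCharacter 𝒜 k (ExtQuiver.rep (k := k) (ExtQuiver.mk (simpleModule k X))) X.1 := by
  obtain ⟨e⟩ := nonempty_rep_iso (simpleModule k X)
  exact (hasCharacter_simpleModule X).of_equiv e.toLinearEquiv

theorem nonempty_arrows_equiv (X Y : 𝒜.IntersectionLattice) :
    Nonempty (@Quiver.Hom (HasseQuiver 𝒜.IntersectionLattice) _ X Y ≃
      ((ExtQuiver.mk (simpleModule k X) : ExtQuiver k (𝒜.FaceAlgebra k)) ⟶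
        ExtQuiver.mk (simpleModule k Y))) := by
  have hX := hasCharacter_rep (k := k) X
  have hY := hasCharacter_rep (k := k) Y
  have hiff := hasCodim_one_iff_covBy (X := X) (Y := Y)
  change Nonempty (PLift (@CovBy 𝒜.IntersectionLattice _ Y X) ≃ Fin (Module.finrank k (Abelian.Ext
    (ExtQuiver.rep (k := k) (ExtQuiver.mk (simpleModule k X)))
    (ExtQuiver.rep (k := k) (ExtQuiver.mk (simpleModule k Y))) 1)))
  obtain ⟨_, x, rfl⟩ := X
  obtain ⟨_, y, rfl⟩ := Y
  by_cases h : HasCodim x.supp 1 y.supp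
  · obtain ⟨e⟩ := nonempty_ext_equiv hX hY h
    rw [e.finrank_eq, Module.finrank_self]
    have : Unique (PLift (@CovBy 𝒜.IntersectionLattice _ ⟨y.supp, y, rfl⟩ ⟨x.supp, x, rfl⟩)) :=
      ⟨⟨⟨hiff.1 h⟩⟩, fun _ => rfl⟩
    exact ⟨Equiv.ofUnique _ _⟩
  · have := subsingleton_ext hX hY h
    rw [Module.finrank_zero_of_subsingleton]
    have : IsEmpty (PLift (@CovBy 𝒜.IntersectionLattice _ ⟨y.supp, y, rfl⟩ ⟨x.supp, x, rfl⟩)) :=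
      ⟨fun hc => h (hiff.2 hc.down)⟩
    exact ⟨Equiv.equivOfIsEmpty _ _⟩

theorem bijective_mk_simpleModule : Function.Bijective fun X : 𝒜.IntersectionLattice =>
    (ExtQuiver.mk (simpleModule k X) : ExtQuiver k (𝒜.FaceAlgebra k)) := by
  constructor
  · rintro ⟨_, x, rfl⟩ ⟨_, y, rfl⟩ h
    obtain ⟨e⟩ : Nonempty (_ ≅ _) := Quotient.exact h
    have hx := hasCharacter_simpleModule (k := k) (⟨x.supp, x, rfl⟩ : 𝒜.IntersectionLattice)
    have hy := hasCharacter_simpleModule (k := k) (⟨y.supp, y, rfl⟩ : 𝒜.IntersectionLattice)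
    have hx' := hx.of_equiv e.toLinearEquiv
    exact Subtype.ext (le_antisymm (hx'.supp_le hy) (hy.supp_le hx'))
  · intro q
    obtain ⟨⟨M, hM⟩, rfl⟩ := Quotient.exists_rep q
    obtain ⟨x, hx⟩ := exists_hasCharacter 𝒜 k M
    obtain ⟨e⟩ := (hasCharacter_simpleModule (k := k)
      (⟨x.supp, x, rfl⟩ : 𝒜.IntersectionLattice)).nonempty_equiv hx
    exact ⟨⟨x.supp, x, rfl⟩, Quotient.sound ⟨e.toModuleIso⟩⟩

end Quiver

end CentralArrangement

theorem mainTheorem5 {d : ℕ} (𝒜 : CentralArrangement d) (k : Type u) [Field k] :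
    (∀ (X Y : 𝒜.IntersectionLattice) (p : ℕ),
      (Y ≤ X ∧ (Module.finrank ℝ X.1 : ℤ) - (Module.finrank ℝ Y.1 : ℤ) = p →
        Nonempty (Abelian.Ext (CentralArrangement.simpleModule k X)
          (CentralArrangement.simpleModule k Y) p ≃ₗ[k] k)) ∧
      (¬ (Y ≤ X ∧ (Module.finrank ℝ X.1 : ℤ) - (Module.finrank ℝ Y.1 : ℤ) = p) →
        Subsingleton (Abelian.Ext (CentralArrangement.simpleModule k X)
          (CentralArrangement.simpleModule k Y) p))) ∧
    IsSplitBasic k (𝒜.FaceAlgebra k) ∧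
    ∃ φ : HasseQuiver 𝒜.IntersectionLattice ⥤q ExtQuiver k (𝒜.FaceAlgebra k),
      (∀ X : 𝒜.IntersectionLattice,
        φ.obj X = ExtQuiver.mk (CentralArrangement.simpleModule k X)) ∧
      Function.Bijective φ.obj ∧
      ∀ X Y : HasseQuiver 𝒜.IntersectionLattice,
        Function.Bijective (φ.map : (X ⟶ Y) → (φ.obj X ⟶ φ.obj Y)) := by
  refine ⟨fun X Y p => ?_, CentralArrangement.isSplitBasic_faceAlgebra, ?_⟩
  · have hX := CentralArrangement.hasCharacter_simpleModule (k := k) X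
    have hY := CentralArrangement.hasCharacter_simpleModule (k := k) Y
    have hiff : (Y ≤ X ∧ (Module.finrank ℝ X.1 : ℤ) - (Module.finrank ℝ Y.1 : ℤ) = p) ↔
        CentralArrangement.HasCodim X.1 p Y.1 :=
      and_congr Iff.rfl (by omega)
    rw [hiff]
    obtain ⟨_, x, rfl⟩ := X
    obtain ⟨_, y, rfl⟩ := Y
    exact ⟨CentralArrangement.nonempty_ext_equiv hX hY, CentralArrangement.subsingleton_ext hX hY⟩
  · have e := fun X Y => (CentralArrangement.nonempty_arrows_equiv (𝒜 := 𝒜) (k := k) X Y).some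
    exact ⟨{ obj := fun X : 𝒜.IntersectionLattice => ExtQuiver.mk (CentralArrangement.simpleModule k X)
             map := fun {X Y} => e X Y }, fun _ => rfl,
      CentralArrangement.bijective_mk_simpleModule, fun X Y => (e X Y).bijective⟩
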